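/- Let $V:\mathbb R^2\to\mathbb R$ be an even Schwartz function (no sign is assumed; in the focusing case $V\le 0$), let $\omega>0$, $\beta<\frac16$, and for $N\ge1$ write $V_N(y)=N^{2\beta}V(N^\beta y)$, $S_j^2=-\Delta_{x_j}+\omega^2|x_j|^2$, $$H_N=\sum_{j=1}^N S_j^2+\frac1N\sum_{1\le i<j\le N}V_N(x_i-x_j),\qquad H_{ij}=S_i^2+S_j^2+\frac{N-1}{N}V_N(x_i-x_j)$$ on $\mathbb R^{2N}\ni(x_1,\dots,x_N)$, $x_j\in\mathbb R^2$. Let $C_{gn}$ be the sharp constant of the Gagliardo–Nirenberg inequality $\|\phi\|_{L^4}\le C\|\phi\|_{L^2}^{1/2}\|\nabla\phi\|_{L^2}^{1/2}$, $\phi\in H^1(\mathbb R^2)$. Expectations are understood as quadratic forms with values in $(-\infty,\infty]$: $\langle\psi,S_j^2\psi\rangle=\|S_j\psi\|_{L^2}^2=\|\nabla_{x_j}\psi\|_{L^2}^2+\omega^2\||x_j|\psi\|_{L^2}^2$, which is $+\infty$ off the form domain. $L^2_s(\mathbb R^{2N})$ denotes the functions of $L^2(\mathbb R^{2N};\mathbb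 C)$ that are invariant under all permutations of $x_1,\dots,x_N$. **Theorem (Stability of Matter).** Assume $\|V\|_{L^1}<\frac{2\alpha}{C_{gn}^4}$ for some $\alpha\in(0,1)$. Then for every $C_0>0$ there is $N_0=N_0(C_0)\in\mathbb N$ such that for all $N>N_0$ and all $\psi_N\in L^2_s(\mathbb R^{2N})$ $$\langle\psi_N,(N^{-1}H_N+C_0)\psi_N\rangle\ \ge\ (1-\alpha)\,\|S_i\psi_N\|_{L^2}^2\qquad(1\le i\le N),$$ and, in the two-body form, $$\langle\psi_N,(2C_0+H_{ij})\psi_N\rangle\ \ge\ 2(1-\alpha)\,\|S_i\psi_N\|_{L^2}^2\qquad(1\le i\ne j\le N).$$ Here the thresholds may be chosen so that $N_0(C_0)\to\infty$ as $C_0\downarrow0$. In particular the $N$-body system is stable once $N$ exceeds a threshold: there are a constant $C$ and an $N_1$ such that $\langle\psi_N,H_N\psi_N\rangle\ge -CN\|\psi_N\|_{L^2}^2$ for all $N>N_1$ and all $\psi_N\in L^2_s(\mathbb R^{2N})$. -/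

import Mathlib

open MeasureTheory
open scoped ENNReal

namespace ManyBody

/-- The position space `ℝ²` of one particle, with its Euclidean norm. -/
abbrev Plane : Type := EuclideanSpace ℝ (Fin 2)

/-- Configurations `(x₁, …, x_N)` of `N` particles in the plane, i.e. `ℝ^{2N}`, with Lebesgue
measure. (The norm of this space is never used.) -/
abbrev Config (N : ℕ) : Type := Fin N → Plane

section WeakDerivative

variable {E : Type*} [NormedAddCommGroup E] [NormedSpace ℝ E] [MeasureSpace E]

/-- `g` is the weak (distributional) derivative of `u` in the direction `v`. -/
def HasWeakDeriv (u g : E → ℂ) (v : E) : Prop :=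
  LocallyIntegrable u volume ∧ LocallyIntegrable g volume ∧
    ∀ φ : E → ℝ, ContDiff ℝ ((⊤ : ℕ∞) : WithTop ℕ∞) φ → HasCompactSupport φ →
      ∫ x, (fderiv ℝ φ x v) • u x = - ∫ x, φ x • g x

/-- `‖∂_v u‖²_{L²} ∈ [0, ∞]`, for the weak derivative `∂_v u`; it is `∞` if `u` has no weak
derivative in the direction `v` that belongs to `L²`. (The weak derivative is unique up to null
sets, so the infimum is over at most one value.) -/
noncomputable def weakDerivNormSq (u : E → ℂ) (v : E) : ℝ≥0∞ :=
  ⨅ (g : E → ℂ) (_ : MemLp g 2 (volume : Measure E)) (_ : HasWeakDeriv u g v), ∫⁻ x, ‖g x‖ₑ ^ 2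

end WeakDerivative

/-- `‖∇φ‖²_{L²} ∈ [0, ∞]` for a function `φ` on the plane. -/
noncomputable def gradNormSq (φ : Plane → ℂ) : ℝ≥0∞ :=
  ∑ a : Fin 2, weakDerivNormSq φ (EuclideanSpace.single a (1 : ℝ))

/-- The sharp constant of the 2D Gagliardo-Nirenberg inequality
`‖φ‖_{L⁴} ≤ C ‖φ‖_{L²}^{1/2} ‖∇φ‖_{L²}^{1/2}`, `φ ∈ H¹(ℝ²)`. -/
noncomputable def gnConst : ℝ :=
  sInf {C : ℝ | 0 ≤ C ∧ ∀ φ : Plane → ℂ, MemLp φ 2 volume → gradNormSq φ < ∞ →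
    eLpNorm φ 4 volume ≤
      ENNReal.ofReal C * eLpNorm φ 2 volume ^ (1 / 2 : ℝ) *
        (gradNormSq φ ^ (1 / 2 : ℝ)) ^ (1 / 2 : ℝ)}

/-- `ψ ∈ L²_s(ℝ^{2N})`: a square integrable function that is invariant under all permutations of
the particles. -/
structure IsBosonic {N : ℕ} (ψ : Config N → ℂ) : Prop where
  memLp : MemLp ψ 2 volume
  symm : ∀ σ : Equiv.Perm (Fin N),
    (fun x : Config N => ψ (fun k => x (σ k))) =ᵐ[volume] ψ

/-- `‖ψ‖²_{L²}`. -/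
noncomputable def normSq {N : ℕ} (ψ : Config N → ℂ) : ℝ :=
  ∫ x, ‖ψ x‖ ^ 2

/-- The unit vector of `ℝ^{2N}` along the coordinate `a` of the particle `j`. -/
noncomputable def coordDir {N : ℕ} (j : Fin N) (a : Fin 2) : Config N :=
  Pi.single j (EuclideanSpace.single a (1 : ℝ))

/-- `‖S_j ψ‖²_{L²} = ⟨ψ, S_j² ψ⟩ ∈ [0, ∞]` with `S_j² = -Δ_{x_j} + ω² |x_j|²`: the closed quadratic
form `‖∇_{x_j} ψ‖² + ω² ‖x_j ψ‖²` of the Hermite operator, which is `∞` off the form domain. -/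
noncomputable def hermiteForm {N : ℕ} (ω : ℝ) (j : Fin N) (ψ : Config N → ℂ) : ℝ≥0∞ :=
  ∑ a : Fin 2, weakDerivNormSq ψ (coordDir j a) +
    ENNReal.ofReal (ω ^ 2) * ∫⁻ x : Config N, ‖x j‖ₑ ^ 2 * ‖ψ x‖ₑ ^ 2

/-- The rescaled potential `V_N(y) = N^{2β} V(N^β y)`. -/
noncomputable def scaledPotential (β : ℝ) (N : ℕ) (V : SchwartzMap Plane ℝ) (y : Plane) : ℝ :=
  (N : ℝ) ^ (2 * β) * V ((N : ℝ) ^ β • y)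

/-- `⟨ψ, V_N(x_i - x_j) ψ⟩`. -/
noncomputable def pairForm {N : ℕ} (β : ℝ) (V : SchwartzMap Plane ℝ) (i j : Fin N)
    (ψ : Config N → ℂ) : ℝ :=
  ∫ x : Config N, scaledPotential β N V (x i - x j) * ‖ψ x‖ ^ 2

/-- `⟨ψ, H_N ψ⟩ ∈ (-∞, ∞]` for the `N`-body Hamiltonian
`H_N = ∑_j (-Δ_{x_j} + ω² |x_j|²) + N⁻¹ ∑_{i<j} V_N(x_i - x_j)`, as a quadratic form
(equal to `∞` off the form domain; the interaction part is bounded). -/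
noncomputable def energy {N : ℕ} (ω β : ℝ) (V : SchwartzMap Plane ℝ) (ψ : Config N → ℂ) : EReal :=
  ((∑ j : Fin N, hermiteForm ω j ψ : ℝ≥0∞) : EReal) +
    (((N : ℝ)⁻¹ * ∑ i : Fin N, ∑ j ∈ Finset.Ioi i, pairForm β V i j ψ : ℝ) : EReal)

/-- `⟨ψ, H_{ij} ψ⟩ ∈ (-∞, ∞]` for the two-body operator
`H_{ij} = S_i² + S_j² + ((N - 1) / N) V_N(x_i - x_j)`, as a quadratic form. -/
noncomputable def twoBodyEnergy {N : ℕ} (ω β : ℝ) (V : SchwartzMap Plane ℝ) (i j : Fin N)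
    (ψ : Config N → ℂ) : EReal :=
  ((hermiteForm ω i ψ + hermiteForm ω j ψ : ℝ≥0∞) : EReal) +
    ((((N : ℝ) - 1) / N * pairForm β V i j ψ : ℝ) : EReal)

end ManyBody

/-!
# Stability of a two-dimensional Bose gas with attractive interaction

For a bosonic `ψ` all one-body energies agree and all pairs have the same interaction energy, so
both energy estimates reduce to `κ ⟨V_N(x₁ - x₂)⟩ ≥ -2α ‖S₁ψ‖² - 2C₀ ‖ψ‖²` with `0 ≤ κ ≤ 1`.
An argument with kernels of positive type gives this for every `β < 1 / 2`.

Let `W` be the kernel with Fourier transform `|V̂|`, rescaled like `V_N`. The kernels `W` and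
`V + W` have nonnegative Fourier transform (`V` is even), and `|V̂| ≤ ‖V‖_{L¹}`.

* Since `V + W` is of positive type, `∑ᵢⱼ (V + W)(xᵢ - xⱼ) ≥ 0`, hence
  `⟨V_N(x₁ - x₂)⟩ ≥ -⟨W_N(x₁ - x₂)⟩ - O(N^{2β - 1})` (`IsBosonic.neg_le_integral_pair`).
* To bound `⟨W_N(x₁ - x₂)⟩` from above, freeze the particles `x₂, …, x_N`, with empirical measure
  `μ`, and let `ρ` be the normalized density of `x₁`. Positivity of `W` gives
  `2 ∬ W_N dρ dμ - ∬ W_N dμ dμ ≤ ∬ W_N dρ dρ`. By Plancherel's theorem the right-hand side is at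
  most `‖V‖_{L¹} ‖ρ‖²_{L²}`, which the Gagliardo–Nirenberg inequality bounds by
  `‖V‖_{L¹} C_gn⁴` times the kinetic energy of `x₁` per unit mass (`two_mul_sum_integral_sub_le`,
  `integral_slice_le`). After integration over `x₂, …, x_N`, symmetry turns the left-hand side into
  `⟨W_N(x₁ - x₂)⟩ - O(N^{2β - 1})` (`IsBosonic.integral_pair_le`).

Together, `⟨V_N(x₁ - x₂)⟩ ≥ -‖V‖_{L¹} C_gn⁴ ‖S₁ψ‖² - O(N^{2β - 1}) ‖ψ‖²`
(`IsBosonic.neg_le_pairForm_hermiteForm`), and `‖V‖_{L¹} C_gn⁴ < 2α`.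

The slicing requires that a weak derivative of `ψ` along the first particle restricts to a weak
derivative on almost every slice (`ae_hasWeakDeriv_slice`).
-/

open MeasureTheory
open scoped ENNReal

namespace ManyBody

/-! ### `L²` and `L⁴` norms as integrals -/

section Lp

variable {X F : Type*} [MeasurableSpace X] {μ : Measure X} [NormedAddCommGroup F]

lemma lintegral_enorm_sq_eq (f : X → F) : ∫⁻ x, ‖f x‖ₑ ^ 2 ∂μ = eLpNorm f 2 μ ^ 2 := by
  have := eLpNorm_nnreal_pow_eq_lintegral (f := f) (μ := μ) (p := 2) (by norm_num)
  norm_num at this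
  exact_mod_cast this.symm

lemma lintegral_enorm_pow_four_eq (f : X → F) :
    ∫⁻ x, ‖f x‖ₑ ^ 4 ∂μ = eLpNorm f 4 μ ^ 4 := by
  have := eLpNorm_nnreal_pow_eq_lintegral (f := f) (μ := μ) (p := 4) (by norm_num)
  norm_num at this
  exact_mod_cast this.symm

lemma integral_norm_sq_eq {f : X → F} (hf : AEStronglyMeasurable f μ) :
    ∫ x, ‖f x‖ ^ 2 ∂μ = (eLpNorm f 2 μ ^ 2).toReal := by
  rw [← lintegral_enorm_sq_eq, integral_eq_lintegral_of_nonneg_ae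
    (f := fun x => ‖f x‖ ^ 2) (.of_forall fun x => by positivity) (hf.norm.pow 2)]
  congr 2 with x
  rw [ENNReal.ofReal_pow (norm_nonneg _), ofReal_norm]

end Lp

/-! ### Plancherel's theorem and cosine transforms -/

section Fourier

open FourierTransform SchwartzMap

/-- A real Schwartz function, regarded as a complex-valued one. -/
noncomputable def complexify {E : Type*} [NormedAddCommGroup E] [NormedSpace ℝ E] (V : 𝓢(E, ℝ)) :
    𝓢(E, ℂ) :=
  postcompCLM (𝕜 := ℝ) Complex.ofRealCLM V

lemma complexify_apply {E : Type*} [NormedAddCommGroup E] [NormedSpace ℝ E] (V : 𝓢(E, ℝ)) (x : E) :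
    complexify V x = V x := rfl

variable {E : Type*} [NormedAddCommGroup E] [InnerProductSpace ℝ E] [FiniteDimensional ℝ E]
  [MeasurableSpace E] [BorelSpace E]

/-- On `L¹ ∩ L²` the Fourier integral represents the `L²` Fourier transform: both have the same
pairing with test functions. -/
lemma fourier_toLp_ae_eq {f : E → ℂ} (hf : Integrable f) (hf2 : MemLp f 2 volume) :
    (𝓕 (hf2.toLp f) : Lp ℂ 2 (volume : Measure E)) =ᵐ[volume] 𝓕 f := by
  have hcont : Continuous (𝓕 f) :=
    VectorFourier.fourierIntegral_continuous Real.continuous_fourierChar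
      (by exact continuous_inner) hf
  refine ae_eq_of_integral_contDiff_smul_eq
    ((Lp.memLp _).locallyIntegrable (by norm_num)) hcont.locallyIntegrable ?_
  intro g hg hgc
  have hg₁ : HasCompactSupport (Complex.ofRealCLM ∘ g) := hgc.comp_left rfl
  have hg₂ : ContDiff ℝ ((⊤ : ℕ∞) : WithTop ℕ∞) (Complex.ofRealCLM ∘ g) := by fun_prop
  set G : 𝓢(E, ℂ) := hg₁.toSchwartzMap hg₂ with hG
  have hGapp : ∀ x, G x = (g x : ℂ) := fun x => rfl
  have h1 := Lp.fourier_toTemperedDistribution_eq (hf2.toLp f)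
  have h2 := congrArg (fun T => T G) h1
  simp only [TemperedDistribution.fourier_apply, Lp.toTemperedDistribution_apply] at h2
  have h3 : ∫ x, (𝓕 G) x • (hf2.toLp f) x = ∫ x, (𝓕 G) x • f x := by
    apply integral_congr_ae
    filter_upwards [hf2.coeFn_toLp] with x hx
    rw [hx]
  have h4 : ∫ x, (𝓕 (G : E → ℂ)) x • f x = ∫ x, G x • (𝓕 f) x := by
    have := VectorFourier.integral_fourierIntegral_smul_eq_flip (μ := (volume : Measure E))
      (ν := (volume : Measure E)) (L := innerₗ E) Real.continuous_fourierChar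
      (by exact continuous_inner) G.integrable hf
    rw [flip_innerₗ] at this
    exact this
  rw [h3, SchwartzMap.fourier_coe, h4] at h2
  have h5 : ∀ u : E → ℂ, ∫ x, G x • u x = ∫ x, g x • u x := fun u => by
    simp [hGapp]
  rw [h5, h5] at h2
  exact h2.symm

/-- Plancherel's theorem for `L¹ ∩ L²`. -/
lemma eLpNorm_fourier_two {f : E → ℂ} (hf : Integrable f) (hf2 : MemLp f 2 volume) :
    MemLp (𝓕 f) 2 volume ∧ eLpNorm (𝓕 f) 2 volume = eLpNorm f 2 volume := by
  have h := fourier_toLp_ae_eq hf hf2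
  refine ⟨(memLp_congr_ae h).1 (Lp.memLp _), ?_⟩
  rw [← eLpNorm_congr_ae h, ← eLpNorm_congr_ae hf2.coeFn_toLp]
  have := Lp.norm_fourier_eq (hf2.toLp f)
  rw [Lp.norm_def, Lp.norm_def] at this
  exact (ENNReal.toReal_eq_toReal_iff' (Lp.eLpNorm_ne_top _) (Lp.eLpNorm_ne_top _)).1 this

/-- The cosine transform `w ↦ ∫ f(v) cos(2π v·w) dv`. -/
noncomputable def cosTransform (f : E → ℝ) (w : E) : ℝ :=
  ∫ v, f v * Real.cos (2 * Real.pi * inner ℝ v w)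

/-- The sine transform `w ↦ ∫ f(v) sin(2π v·w) dv`. -/
noncomputable def sinTransform (f : E → ℝ) (w : E) : ℝ :=
  ∫ v, f v * Real.sin (2 * Real.pi * inner ℝ v w)

lemma integrable_mul_cos {f : E → ℝ} (hf : Integrable f) (w : E) :
    Integrable fun v => f v * Real.cos (2 * Real.pi * inner ℝ v w) :=
  hf.mul_bdd (c := 1) (by fun_prop) (.of_forall fun v => Real.abs_cos_le_one _)

lemma integrable_mul_sin {f : E → ℝ} (hf : Integrable f) (w : E) :
    Integrable fun v => f v * Real.sin (2 * Real.pi * inner ℝ v w) :=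
  hf.mul_bdd (c := 1) (by fun_prop) (.of_forall fun v => Real.abs_sin_le_one _)

lemma fourier_ofReal {f : E → ℝ} (hf : Integrable f) (w : E) :
    𝓕 (fun v => (f v : ℂ)) w = cosTransform f w - sinTransform f w * Complex.I := by
  rw [Real.fourier_eq', cosTransform, sinTransform, ← integral_complex_ofReal,
    ← integral_complex_ofReal, ← integral_mul_const, ← integral_sub]
  · congr 1 with v
    have : ((-2 * Real.pi * inner ℝ v w : ℝ) : ℂ) = -((2 * Real.pi * inner ℝ v w : ℝ) : ℂ) := by
      push_cast; ring
    rw [this, Complex.exp_mul_I, Complex.cos_neg, Complex.sin_neg, smul_eq_mul]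
    simp only [Complex.ofReal_mul (f v), Complex.ofReal_cos, Complex.ofReal_sin]
    ring
  · exact (integrable_mul_cos hf w).ofReal
  · exact (integrable_mul_sin hf w).ofReal.mul_const _

lemma continuous_cosTransform {f : E → ℝ} (hf : Integrable f) : Continuous (cosTransform f) := by
  have hcont : Continuous (𝓕 fun v => (f v : ℂ)) :=
    VectorFourier.fourierIntegral_continuous Real.continuous_fourierChar
      (by exact continuous_inner) hf.ofReal
  convert Complex.continuous_re.comp hcont using 1
  ext w
  simp [fourier_ofReal hf]

lemma continuous_sinTransform {f : E → ℝ} (hf : Integrable f) : Continuous (sinTransform f) := by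
  have hcont : Continuous (𝓕 fun v => (f v : ℂ)) :=
    VectorFourier.fourierIntegral_continuous Real.continuous_fourierChar
      (by exact continuous_inner) hf.ofReal
  convert (Complex.continuous_im.comp hcont).neg using 1
  ext w
  simp [fourier_ofReal hf]

lemma abs_cosTransform_le {f : E → ℝ} (hf : Integrable f) (w : E) :
    |cosTransform f w| ≤ ∫ v, |f v| := by
  refine (abs_integral_le_integral_abs).trans
    (integral_mono (integrable_mul_cos hf w).abs hf.abs fun v => ?_)
  simp only [abs_mul]
  exact mul_le_of_le_one_right (abs_nonneg _) (Real.abs_cos_le_one _)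

lemma abs_sinTransform_le {f : E → ℝ} (hf : Integrable f) (w : E) :
    |sinTransform f w| ≤ ∫ v, |f v| := by
  refine (abs_integral_le_integral_abs).trans
    (integral_mono (integrable_mul_sin hf w).abs hf.abs fun v => ?_)
  simp only [abs_mul]
  exact mul_le_of_le_one_right (abs_nonneg _) (Real.abs_sin_le_one _)

/-- Plancherel's theorem for a real function, in terms of its cosine and sine transforms. -/
lemma integral_cosTransform_sq_add {f : E → ℝ} (hf : Integrable f) (hf2 : MemLp f 2 volume) :
    Integrable (fun w => cosTransform f w ^ 2 + sinTransform f w ^ 2) ∧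
      ∫ w, (cosTransform f w ^ 2 + sinTransform f w ^ 2) = ∫ v, f v ^ 2 := by
  have hfc : MemLp (fun v => (f v : ℂ)) 2 volume := hf2.ofReal
  have hfi : Integrable (fun v => (f v : ℂ)) := hf.ofReal
  obtain ⟨h1, h2⟩ := eLpNorm_fourier_two hfi hfc
  have hsq : ∀ w, ‖𝓕 (fun v => (f v : ℂ)) w‖ ^ 2 = cosTransform f w ^ 2 + sinTransform f w ^ 2 := by
    intro w
    rw [fourier_ofReal hf, ← Complex.normSq_eq_norm_sq, Complex.normSq_apply]
    simp
    ring
  have h3 := (memLp_two_iff_integrable_sq_norm h1.1).1 h1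
  simp only [hsq] at h3
  refine ⟨h3, ?_⟩
  have h4 := integral_norm_sq_eq h1.aestronglyMeasurable
  have h5 := integral_norm_sq_eq hfc.aestronglyMeasurable
  rw [h2, ← h5] at h4
  simpa only [hsq, Complex.norm_real, Real.norm_eq_abs, sq_abs] using h4

/-- `∑ᵢⱼ k̂(xᵢ - xⱼ) = ∫ k |∑ⱼ e^{2πi v·xⱼ}|²`. -/
lemma sum_sum_cosTransform {ι : Type*} [Fintype ι] {k : E → ℝ} (hk : Integrable k) (x : ι → E) :
    ∑ i, ∑ j, cosTransform k (x i - x j) =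
      ∫ v, k v * ((∑ i, Real.cos (2 * Real.pi * inner ℝ v (x i))) ^ 2 +
        (∑ i, Real.sin (2 * Real.pi * inner ℝ v (x i))) ^ 2) := by
  simp only [cosTransform]
  rw [← Finset.sum_congr rfl fun i _ => integral_finsetSum Finset.univ
    fun j _ => integrable_mul_cos hk (x i - x j), ← integral_finsetSum Finset.univ
    fun i _ => integrable_finsetSum Finset.univ fun j _ => integrable_mul_cos hk (x i - x j)]
  congr 1 with v
  simp only [inner_sub_right, mul_sub, Real.cos_sub, ← Finset.mul_sum, Finset.sum_add_distrib, sq,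
    Finset.sum_mul_sum]

/-- A kernel with nonnegative cosine transform is of positive type. -/
lemma sum_sum_cosTransform_nonneg {ι : Type*} [Fintype ι] {k : E → ℝ} (hk : Integrable k)
    (hk0 : ∀ v, 0 ≤ k v) (x : ι → E) : 0 ≤ ∑ i, ∑ j, cosTransform k (x i - x j) := by
  rw [sum_sum_cosTransform hk]
  exact integral_nonneg fun v => mul_nonneg (hk0 v) (by positivity)

/-- Smearing the kernel `k̂(l (x - y))` with a density `p` in `x`, computed on the Fourier side. -/
lemma integral_mul_cosTransform {k p : E → ℝ} (hk : Integrable k) (hp : Integrable p) (l : ℝ)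
    (y : E) :
    ∫ x, p x * cosTransform k (l • (x - y)) =
      ∫ v, k v * (cosTransform p (l • v) * Real.cos (2 * Real.pi * inner ℝ v (l • y)) +
        sinTransform p (l • v) * Real.sin (2 * Real.pi * inner ℝ v (l • y))) := by
  have hint : Integrable (Function.uncurry fun (x v : E) =>
      p x * (k v * Real.cos (2 * Real.pi * inner ℝ v (l • (x - y))))) (volume.prod volume) := by
    have h := (hp.mul_prod hk).mul_bdd (c := 1)
      (g := fun z : E × E => Real.cos (2 * Real.pi * inner ℝ z.2 (l • (z.1 - y))))
      (by fun_prop) (.of_forall fun v => Real.abs_cos_le_one _)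
    refine h.congr (.of_forall fun z => ?_)
    simp only [Function.uncurry]
    ring
  simp only [cosTransform, sinTransform, ← integral_const_mul]
  rw [integral_integral_swap hint]
  congr 1 with v
  rw [← integral_mul_const, ← integral_mul_const, ← integral_add, ← integral_const_mul]
  · congr 1 with x
    simp only [inner_smul_right, inner_sub_right, mul_sub, Real.cos_sub, real_inner_comm v x]
    ring
  · exact (integrable_mul_cos hp _).mul_const _
  · exact (integrable_mul_sin hp _).mul_const _

/-- Completing the square. For a kernel `K(x) = k̂(l x)` of positive type, the interaction of a
density `p` with a cloud of points, minus the self-interaction of the cloud, is at most the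
self-interaction of `p`, which Plancherel's theorem bounds by `‖k‖_∞ l⁻ᵈ ‖p‖²_{L²}`. -/
lemma two_mul_sum_integral_sub_le {ι : Type*} [Fintype ι] {k p : E → ℝ} (hk : Integrable k)
    (hk0 : ∀ v, 0 ≤ k v) {B : ℝ} (hkB : ∀ v, k v ≤ B) (hp : Integrable p)
    (hp2 : MemLp p 2 volume) {l : ℝ} (hl : 0 < l) (y : ι → E) (a : ℝ) :
    2 * a * ∑ j, (∫ x, p x * cosTransform k (l • (x - y j))) -
        a ^ 2 * ∑ i, ∑ j, cosTransform k (l • (y i - y j)) ≤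
      B * ((l ^ Module.finrank ℝ E)⁻¹ * ∫ x, p x ^ 2) := by
  obtain ⟨hi, he⟩ := integral_cosTransform_sq_add hp hp2
  set C : E → ℝ := fun v => ∑ j, Real.cos (2 * Real.pi * inner ℝ v (l • y j)) with hC
  set S : E → ℝ := fun v => ∑ j, Real.sin (2 * Real.pi * inner ℝ v (l • y j)) with hS
  have hPc : Continuous fun v => cosTransform p (l • v) :=
    (continuous_cosTransform hp).comp (continuous_const_smul l)
  have hPs : Continuous fun v => sinTransform p (l • v) :=
    (continuous_sinTransform hp).comp (continuous_const_smul l)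
  have hil : Integrable fun v : E => cosTransform p (l • v) ^ 2 + sinTransform p (l • v) ^ 2 :=
    hi.comp_smul hl.ne'
  have hcross : ∑ j, ∫ x, p x * cosTransform k (l • (x - y j)) =
      ∫ v, k v * (cosTransform p (l • v) * C v + sinTransform p (l • v) * S v) := by
    simp only [integral_mul_cosTransform hk hp]
    rw [← integral_finsetSum]
    · congr 1 with v
      rw [hC, hS, Finset.mul_sum, Finset.mul_sum, ← Finset.sum_add_distrib, Finset.mul_sum]
    · intro j _
      refine hk.mul_bdd (c := (∫ v, |p v|) + ∫ v, |p v|) (by fun_prop) (.of_forall fun v => ?_)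
      refine (norm_add_le _ _).trans (add_le_add ?_ ?_) <;> rw [norm_mul]
      · exact (mul_le_of_le_one_right (norm_nonneg _) (Real.abs_cos_le_one _)).trans
          (abs_cosTransform_le hp _)
      · exact (mul_le_of_le_one_right (norm_nonneg _) (Real.abs_sin_le_one _)).trans
          (abs_sinTransform_le hp _)
  have hself : ∑ i, ∑ j, cosTransform k (l • (y i - y j)) = ∫ v, k v * (C v ^ 2 + S v ^ 2) := by
    simp only [smul_sub]
    exact sum_sum_cosTransform hk fun i => l • y i
  have hCb : ∀ v, |C v| ≤ Fintype.card ι := fun v => by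
    refine (Finset.abs_sum_le_sum_abs _ _).trans ?_
    refine (Finset.sum_le_card_nsmul _ _ 1 fun i _ => Real.abs_cos_le_one _).trans (by simp)
  have hSb : ∀ v, |S v| ≤ Fintype.card ι := fun v => by
    refine (Finset.abs_sum_le_sum_abs _ _).trans ?_
    refine (Finset.sum_le_card_nsmul _ _ 1 fun i _ => Real.abs_sin_le_one _).trans (by simp)
  have hCc : Continuous C := by rw [hC]; fun_prop
  have hSc : Continuous S := by rw [hS]; fun_prop
  have hPcb : ∀ v, |cosTransform p (l • v)| ≤ ∫ v, |p v| := fun v => abs_cosTransform_le hp _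
  have hPsb : ∀ v, |sinTransform p (l • v)| ≤ ∫ v, |p v| := fun v => abs_sinTransform_le hp _
  have hM : 0 ≤ ∫ v, |p v| := integral_nonneg fun v => abs_nonneg _
  have i1 : Integrable fun v => k v * (cosTransform p (l • v) * C v +
      sinTransform p (l • v) * S v) := by
    refine hk.mul_bdd (c := (∫ v, |p v|) * Fintype.card ι + (∫ v, |p v|) * Fintype.card ι)
      (by fun_prop) (.of_forall fun v => ?_)
    refine (norm_add_le _ _).trans (add_le_add ?_ ?_) <;> rw [norm_mul]
    · exact mul_le_mul (hPcb v) (hCb v) (abs_nonneg _) hM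
    · exact mul_le_mul (hPsb v) (hSb v) (abs_nonneg _) hM
  have i2 : Integrable fun v => k v * (C v ^ 2 + S v ^ 2) := by
    refine hk.mul_bdd (c := (Fintype.card ι : ℝ) ^ 2 + (Fintype.card ι : ℝ) ^ 2)
      (by fun_prop) (.of_forall fun v => ?_)
    refine (norm_add_le _ _).trans (add_le_add ?_ ?_) <;> rw [norm_pow]
    · exact pow_le_pow_left₀ (abs_nonneg _) (hCb v) 2
    · exact pow_le_pow_left₀ (abs_nonneg _) (hSb v) 2
  rw [hcross, hself, ← integral_const_mul, ← integral_const_mul,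
    ← integral_sub (i1.const_mul _) (i2.const_mul _)]
  have hscale : (∫ v, (cosTransform p (l • v) ^ 2 + sinTransform p (l • v) ^ 2)) =
      (l ^ Module.finrank ℝ E)⁻¹ * ∫ x, p x ^ 2 := by
    rw [Measure.integral_comp_smul volume
      (fun w => cosTransform p w ^ 2 + sinTransform p w ^ 2) l, he, smul_eq_mul,
      abs_of_nonneg (by positivity)]
  rw [← hscale, ← integral_const_mul]
  refine integral_mono ((i1.const_mul _).sub (i2.const_mul _)) (hil.const_mul B) fun v => ?_
  have h1 : 2 * a * (cosTransform p (l • v) * C v + sinTransform p (l • v) * S v) -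
      a ^ 2 * (C v ^ 2 + S v ^ 2) ≤ cosTransform p (l • v) ^ 2 + sinTransform p (l • v) ^ 2 := by
    nlinarith [sq_nonneg (cosTransform p (l • v) - a * C v),
      sq_nonneg (sinTransform p (l • v) - a * S v)]
  calc _ = k v * (2 * a * (cosTransform p (l • v) * C v + sinTransform p (l • v) * S v) -
      a ^ 2 * (C v ^ 2 + S v ^ 2)) := by ring
    _ ≤ k v * (cosTransform p (l • v) ^ 2 + sinTransform p (l • v) ^ 2) :=
      mul_le_mul_of_nonneg_left h1 (hk0 v)
    _ ≤ _ := mul_le_mul_of_nonneg_right (hkB v) (by positivity)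

/-- An even Schwartz function is the cosine transform of the real part of its Fourier
transform. -/
lemma cosTransform_re_fourier {V : 𝓢(E, ℝ)} (hV : ∀ y, V (-y) = V y) (y : E) :
    cosTransform (fun v => (𝓕 (complexify V) v).re) y = V y := by
  have hint : Integrable (fun v => 𝓕 (complexify V) v) := (𝓕 (complexify V)).integrable
  have hinv : ∀ z : E, 𝓕⁻ (fun v => 𝓕 (complexify V) v) z = V z := fun z => by
    erw [← SchwartzMap.fourierInv_coe]; rw [fourierInv_fourier_eq, complexify_apply]
  have hexp : ∀ z : E, Integrable fun v : E =>
      Complex.exp (↑(2 * Real.pi * inner ℝ v z) * Complex.I) • 𝓕 (complexify V) v := fun z => by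
    refine hint.bdd_mul (c := 1) (by fun_prop) (.of_forall fun v => ?_)
    rw [Complex.norm_exp_ofReal_mul_I]
  have hsum : (V y : ℂ) + V (-y) =
      ∫ v, (2 * Real.cos (2 * Real.pi * inner ℝ v y) : ℝ) • 𝓕 (complexify V) v := by
    rw [← hinv, ← hinv, Real.fourierInv_eq', Real.fourierInv_eq',
      ← integral_add (hexp y) (hexp (-y))]
    congr 1 with v
    rw [inner_neg_right, mul_neg, Complex.ofReal_neg, Complex.exp_mul_I, Complex.exp_mul_I,
      Complex.cos_neg, Complex.sin_neg, ← add_smul, Complex.real_smul, smul_eq_mul]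
    push_cast
    ring
  have hint2 : Integrable fun v =>
      (2 * Real.cos (2 * Real.pi * inner ℝ v y) : ℝ) • 𝓕 (complexify V) v := by
    refine hint.bdd_smul (φ := fun v => 2 * Real.cos (2 * Real.pi * inner ℝ v y)) 2
      (by fun_prop) (.of_forall fun v => ?_)
    rw [norm_mul]
    simpa using Real.abs_cos_le_one _
  have hre := congrArg Complex.re hsum
  have h2 := integral_re hint2
  simp only [RCLike.re_to_complex] at h2
  rw [← h2, hV] at hre
  simp only [Complex.add_re, Complex.ofReal_re, Complex.smul_re, smul_eq_mul, mul_assoc,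
    integral_const_mul] at hre
  rw [cosTransform]
  simp only [mul_comm (Complex.re _), mul_assoc]
  linarith

lemma norm_fourier_complexify_le (V : 𝓢(E, ℝ)) (v : E) :
    ‖𝓕 (complexify V) v‖ ≤ ∫ y, |V y| := by
  rw [SchwartzMap.fourier_coe]
  refine (VectorFourier.norm_fourierIntegral_le_integral_norm _ _ _ _ _).trans (le_of_eq ?_)
  simp [complexify_apply]

end Fourier

/-! ### The Gagliardo–Nirenberg inequality with its sharp constant -/

/-- If `gnConst ≠ 0`, then the set whose infimum it is is nonempty, and the infimum itself is an
admissible constant. -/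
lemma lintegral_pow_four_le_of_gnConst_ne_zero (h0 : gnConst ≠ 0) {φ : Plane → ℂ}
    (hφ : MemLp φ 2 volume) (hgrad : gradNormSq φ < ∞) :
    ∫⁻ x, ‖φ x‖ₑ ^ 4 ≤
      ENNReal.ofReal (gnConst ^ 4) * (∫⁻ x, ‖φ x‖ₑ ^ 2) * gradNormSq φ := by
  set S := {C : ℝ | 0 ≤ C ∧ ∀ φ : Plane → ℂ, MemLp φ 2 volume → gradNormSq φ < ∞ →
    eLpNorm φ 4 volume ≤
      ENNReal.ofReal C * eLpNorm φ 2 volume ^ (1 / 2 : ℝ) *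
        (gradNormSq φ ^ (1 / 2 : ℝ)) ^ (1 / 2 : ℝ)} with hS
  have hne : S.Nonempty := by
    by_contra hemp
    rw [Set.not_nonempty_iff_eq_empty] at hemp
    exact h0 (by rw [gnConst, ← hS, hemp, Real.sInf_empty])
  have hbdd : BddBelow S := ⟨0, fun C hC => hC.1⟩
  obtain ⟨u, -, hu, huS⟩ := exists_seq_tendsto_sInf hne hbdd
  have hgn0 : 0 ≤ gnConst := Real.sInf_nonneg fun C hC => hC.1
  have hlim : Filter.Tendsto (fun n => ENNReal.ofReal (u n) * (eLpNorm φ 2 volume ^ (1 / 2 : ℝ) *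
        (gradNormSq φ ^ (1 / 2 : ℝ)) ^ (1 / 2 : ℝ))) Filter.atTop
      (nhds (ENNReal.ofReal gnConst * (eLpNorm φ 2 volume ^ (1 / 2 : ℝ) *
        (gradNormSq φ ^ (1 / 2 : ℝ)) ^ (1 / 2 : ℝ)))) := by
    refine ENNReal.Tendsto.mul_const (ENNReal.tendsto_ofReal hu) (Or.inr ?_)
    refine ENNReal.mul_ne_top (ENNReal.rpow_ne_top_of_nonneg (by norm_num) hφ.eLpNorm_ne_top) ?_
    exact ENNReal.rpow_ne_top_of_nonneg (by norm_num)
      (ENNReal.rpow_ne_top_of_nonneg (by norm_num) hgrad.ne)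
  have hle := ge_of_tendsto' hlim fun n => by
    rw [← mul_assoc]
    exact (huS n).2 φ hφ hgrad
  have hfour := pow_le_pow_left' hle 4
  rw [lintegral_enorm_sq_eq, lintegral_enorm_pow_four_eq]
  refine hfour.trans (le_of_eq ?_)
  rw [← mul_assoc, mul_pow, mul_pow, ENNReal.ofReal_pow hgn0]
  congr 1
  · congr 1
    rw [← ENNReal.rpow_natCast, ← ENNReal.rpow_mul, ← ENNReal.rpow_natCast]
    norm_num
  · rw [← ENNReal.rpow_natCast, ← ENNReal.rpow_mul, ← ENNReal.rpow_mul]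
    norm_num

/-! ### Slicing off the first particle -/

/-- The configuration with first particle at `z.1` and the other particles at `z.2`. -/
def consConfig {n : ℕ} (z : Plane × Config n) : Config (n + 1) := Fin.cons z.1 z.2

@[simp] lemma consConfig_zero {n : ℕ} (z : Plane × Config n) : consConfig z 0 = z.1 := rfl

lemma measurePreserving_consConfig {n : ℕ} :
    MeasurePreserving (consConfig (n := n)) (volume.prod volume) volume := by
  have h := (volume_preserving_piFinSuccAbove (fun _ : Fin (n + 1) => Plane) 0).symm
  have hcons : ⇑(MeasurableEquiv.piFinSuccAbove (fun _ : Fin (n + 1) => Plane) 0).symm =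
      consConfig (n := n) := by
    ext z
    simp [MeasurableEquiv.piFinSuccAbove]
    rfl
  rwa [hcons] at h

lemma measurableEmbedding_consConfig {n : ℕ} : MeasurableEmbedding (consConfig (n := n)) := by
  have h := (MeasurableEquiv.piFinSuccAbove (fun _ : Fin (n + 1) => Plane) 0).symm.measurableEmbedding
  convert h using 1
  ext z
  simp [MeasurableEquiv.piFinSuccAbove]
  rfl

lemma ae_memLp_two_slice {X Y : Type*} [MeasurableSpace X] [MeasurableSpace Y] {μ : Measure X}
    {ν : Measure Y} [SFinite μ] [SFinite ν] {u : X × Y → ℂ} (hu : MemLp u 2 (μ.prod ν)) :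
    ∀ᵐ y ∂ν, MemLp (fun x => u (x, y)) 2 μ := by
  have h1 := ((memLp_two_iff_integrable_sq_norm hu.1).1 hu).prod_left_ae
  have h2 := hu.1.prod_swap.prodMk_left
  filter_upwards [h1, h2] with y h1 h2
  exact (memLp_two_iff_integrable_sq_norm h2).2 h1

lemma memLp_two_mul_prod {X Y : Type*} [MeasurableSpace X] [MeasurableSpace Y] {μ : Measure X}
    {ν : Measure Y} [SFinite ν] {f : X → ℝ} {g : Y → ℝ} (hf : MemLp f 2 μ) (hg : MemLp g 2 ν) :
    MemLp (fun z : X × Y => f z.1 * g z.2) 2 (μ.prod ν) := by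
  have h := hf.1.comp_fst (ν := ν) |>.mul (hg.1.comp_snd (μ := μ))
  refine (memLp_two_iff_integrable_sq h).2 ?_
  simpa only [Pi.mul_apply, mul_pow] using hf.integrable_sq.mul_prod hg.integrable_sq

/-- Pairing the first variable with a test function leaves a locally integrable function. -/
lemma locallyIntegrable_integral_smul {n : ℕ} {φ : Plane → ℝ} (hφ : MemLp φ 2 volume)
    {u : Plane × Config n → ℂ} (hu : MemLp u 2 (volume.prod volume)) :
    LocallyIntegrable (fun y => ∫ x, φ x • u (x, y)) volume := by
  rw [locallyIntegrable_iff]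
  intro K hK
  have : IsFiniteMeasure (volume.restrict K : Measure (Config n)) :=
    ⟨by simpa using hK.measure_lt_top⟩
  have hφ' : MemLp (fun z : Plane × Config n => φ z.1) 2 (volume.prod (volume.restrict K)) :=
    hφ.comp_fst _
  have hu' : MemLp u 2 (volume.prod (volume.restrict K)) := by
    refine hu.mono_measure ?_
    conv_lhs => rw [← Measure.restrict_univ (μ := (volume : Measure Plane))]
    rw [Measure.prod_restrict]
    exact Measure.restrict_le_self
  have hint : Integrable (fun z => φ z.1 • u z) (volume.prod (volume.restrict K)) :=
    memLp_one_iff_integrable.1 (hu'.smul (r := 1) hφ')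
  exact hint.integral_prod_right

/-- A weak derivative along the first particle restricts, for each test function, to almost every
slice. -/
lemma ae_integral_slice_eq {n : ℕ} {a : Fin 2} {ψ g : Config (n + 1) → ℂ}
    (hψ : MemLp ψ 2 volume) (hg : MemLp g 2 volume) (h : HasWeakDeriv ψ g (coordDir 0 a))
    {φ : Plane → ℝ} (hφ : ContDiff ℝ ((⊤ : ℕ∞) : WithTop ℕ∞) φ) (hφc : HasCompactSupport φ) :
    ∀ᵐ y : Config n, ∫ x, (fderiv ℝ φ x (EuclideanSpace.single a 1)) • ψ (consConfig (x, y)) =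
      - ∫ x, φ x • g (consConfig (x, y)) := by
  have hψ' : MemLp (ψ ∘ consConfig) 2 (volume.prod volume) :=
    hψ.comp_measurePreserving measurePreserving_consConfig
  have hg' : MemLp (g ∘ consConfig) 2 (volume.prod volume) :=
    hg.comp_measurePreserving measurePreserving_consConfig
  set dφ : Plane → ℝ := fun x => fderiv ℝ φ x (EuclideanSpace.single a 1) with hdφ
  have hdc : Continuous dφ := (hφ.continuous_fderiv (by simp)).clm_apply continuous_const
  have hdcs : HasCompactSupport dφ := hφc.fderiv_apply (𝕜 := ℝ) _
  have hdL : MemLp dφ 2 volume := hdc.memLp_of_hasCompactSupport hdcs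
  have hφL : MemLp φ 2 volume := hφ.continuous.memLp_of_hasCompactSupport hφc
  refine ae_eq_of_integral_contDiff_smul_eq (locallyIntegrable_integral_smul hdL hψ')
    (locallyIntegrable_integral_smul hφL hg').neg ?_
  intro χ hχ hχc
  have hχL : MemLp χ 2 (volume : Measure (Config n)) :=
    hχ.continuous.memLp_of_hasCompactSupport hχc
  -- the pairing of a product test function, by Fubini
  have key : ∀ (η : Plane → ℝ) (u : Config (n + 1) → ℂ), MemLp η 2 volume → MemLp u 2 volume →
      ∫ y, χ y • ∫ x, η x • u (consConfig (x, y)) =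
        ∫ x, (η (x 0) * χ (Fin.tail x)) • u x := by
    intro η u hη hu
    have hu' : MemLp (u ∘ consConfig) 2 (volume.prod volume) :=
      hu.comp_measurePreserving measurePreserving_consConfig
    have hηχ : MemLp (fun z : Plane × Config n => η z.1 * χ z.2) 2 (volume.prod volume) :=
      memLp_two_mul_prod hη hχL
    have hint : Integrable (fun z : Plane × Config n => (η z.1 * χ z.2) • u (consConfig z))
        (volume.prod volume) :=
      memLp_one_iff_integrable.1 (hu'.smul (r := 1) hηχ)
    rw [← measurePreserving_consConfig.integral_comp measurableEmbedding_consConfig]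
    simp only [consConfig_zero]
    have htail : ∀ z : Plane × Config n, Fin.tail (consConfig z) = z.2 := fun z => rfl
    simp only [htail]
    rw [integral_prod_symm _ hint]
    congr 1 with y
    rw [← integral_smul]
    congr 1 with x
    rw [smul_smul, mul_comm]
  simp only [smul_neg, integral_neg]
  rw [key dφ ψ hdL hψ, key φ g hφL hg]
  have hΦ : ContDiff ℝ ((⊤ : ℕ∞) : WithTop ℕ∞)
      fun x : Config (n + 1) => φ (x 0) * χ (Fin.tail x) := by
    have h1 : ContDiff ℝ ((⊤ : ℕ∞) : WithTop ℕ∞) fun x : Config (n + 1) => Fin.tail x :=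
      contDiff_pi.2 fun i => contDiff_apply ℝ Plane i.succ
    exact (hφ.comp (contDiff_apply ℝ Plane 0)).mul (hχ.comp h1)
  have hΦc : HasCompactSupport fun x : Config (n + 1) => φ (x 0) * χ (Fin.tail x) := by
    have hcons : Continuous (consConfig (n := n)) := by
      refine continuous_pi fun i => ?_
      refine Fin.cases ?_ (fun j => ?_) i
      · exact continuous_fst
      · exact (continuous_apply j).comp continuous_snd
    refine HasCompactSupport.intro ((hφc.isCompact.prod hχc.isCompact).image hcons) fun x hx => ?_
    by_contra hne
    refine hx ⟨(x 0, Fin.tail x), ⟨subset_tsupport _ fun h0 => hne ?_,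
      subset_tsupport _ fun h0 => hne ?_⟩, ?_⟩
    · simp only at h0; simp [h0]
    · simp only at h0; simp [h0]
    · exact Fin.cons_self_tail x
  rw [← h.2.2 _ hΦ hΦc]
  congr 1 with x
  congr 1
  have hd1 : HasFDerivAt (fun x : Config (n + 1) => φ (x 0))
      ((fderiv ℝ φ (x 0)).comp (ContinuousLinearMap.proj 0)) x :=
    HasFDerivAt.comp x (hφ.differentiable (by simp) (x 0)).hasFDerivAt
      (ContinuousLinearMap.proj (R := ℝ) (φ := fun _ : Fin (n + 1) => Plane) 0).hasFDerivAt
  have hd2 : HasFDerivAt (fun x : Config (n + 1) => χ (Fin.tail x))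
      ((fderiv ℝ χ (Fin.tail x)).comp (ContinuousLinearMap.pi fun i : Fin n =>
        ContinuousLinearMap.proj (R := ℝ) (φ := fun _ : Fin (n + 1) => Plane) i.succ)) x :=
    HasFDerivAt.comp x (hχ.differentiable (by simp) (Fin.tail x)).hasFDerivAt
      (ContinuousLinearMap.pi fun i : Fin n =>
        ContinuousLinearMap.proj (R := ℝ) (φ := fun _ : Fin (n + 1) => Plane) i.succ).hasFDerivAt
  have hmul : fderiv ℝ (fun x : Config (n + 1) => φ (x 0) * χ (Fin.tail x)) x = _ :=
    (hd1.mul hd2).fderiv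
  rw [hmul]
  have h0 : (ContinuousLinearMap.pi fun i : Fin n => ContinuousLinearMap.proj (R := ℝ)
      (φ := fun _ : Fin (n + 1) => Plane) i.succ) (coordDir 0 a) = 0 := by
    ext i
    simp [coordDir]
  simp only [add_apply, smul_apply,
    ContinuousLinearMap.comp_apply, h0, map_zero, smul_eq_mul]
  simp [coordDir, hdφ, mul_comm]

/-- The weak derivative along the first particle restricts to almost every slice. Separability of
`L²` reduces the exceptional sets of all test functions to countably many. -/
lemma ae_hasWeakDeriv_slice {n : ℕ} {a : Fin 2} {ψ g : Config (n + 1) → ℂ}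
    (hψ : MemLp ψ 2 volume) (hg : MemLp g 2 volume) (h : HasWeakDeriv ψ g (coordDir 0 a)) :
    ∀ᵐ y : Config n, HasWeakDeriv (fun x => ψ (consConfig (x, y)))
      (fun x => g (consConfig (x, y))) (EuclideanSpace.single a 1) := by
  let T := {φ : Plane → ℝ // ContDiff ℝ ((⊤ : ℕ∞) : WithTop ℕ∞) φ ∧ HasCompactSupport φ}
  have hdL : ∀ φ : T, MemLp (fun x => ((fderiv ℝ φ.1 x (EuclideanSpace.single a 1) : ℝ) : ℂ)) 2
      (volume : Measure Plane) := fun φ =>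
    (((φ.2.1.continuous_fderiv (by simp)).clm_apply continuous_const).memLp_of_hasCompactSupport
      (φ.2.2.fderiv_apply (𝕜 := ℝ) _)).ofReal
  have hL : ∀ φ : T, MemLp (fun x => (φ.1 x : ℂ)) 2 (volume : Measure Plane) := fun φ =>
    (φ.2.1.continuous.memLp_of_hasCompactSupport φ.2.2).ofReal
  let F : T → Lp ℂ 2 (volume : Measure Plane) × Lp ℂ 2 (volume : Measure Plane) :=
    fun φ => ((hdL φ).toLp _, (hL φ).toLp _)
  have : Fact ((2 : ℝ≥0∞) ≠ ∞) := ⟨by simp⟩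
  have : SecondCountableTopology (Lp ℂ 2 (volume : Measure Plane)) := inferInstance
  obtain ⟨c, hcF, hcc, hcd⟩ :=
    (TopologicalSpace.IsSeparable.of_separableSpace (Set.range F)).exists_countable_dense_subset
  have := hcc.to_subtype
  choose φ hφ using fun p : c => hcF p.2
  have hall : ∀ᵐ y : Config n, ∀ p : c,
      ∫ x, (fderiv ℝ (φ p).1 x (EuclideanSpace.single a 1)) • ψ (consConfig (x, y)) =
        - ∫ x, (φ p).1 x • g (consConfig (x, y)) :=
    ae_all_iff.2 fun p => ae_integral_slice_eq hψ hg h (φ p).2.1 (φ p).2.2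
  have hsψ := ae_memLp_two_slice (hψ.comp_measurePreserving measurePreserving_consConfig)
  have hsg := ae_memLp_two_slice (hg.comp_measurePreserving measurePreserving_consConfig)
  filter_upwards [hall, hsψ, hsg] with y hy h1 h2
  -- the defect in the definition of the weak derivative is continuous for the `L²` norms
  set D : Lp ℂ 2 (volume : Measure Plane) × Lp ℂ 2 (volume : Measure Plane) → ℂ :=
    fun p => inner ℂ p.1 (h1.toLp _) + inner ℂ p.2 (h2.toLp _) with hD
  have hDc : Continuous D := by rw [hD]; fun_prop
  have hinner : ∀ (η : Plane → ℝ) (hη : MemLp (fun x => (η x : ℂ)) 2 (volume : Measure Plane))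
      (u : Plane → ℂ) (hu : MemLp u 2 volume),
      inner ℂ (hη.toLp _) (hu.toLp _) = ∫ x, η x • u x := by
    intro η hη u hu
    rw [L2.inner_def]
    refine integral_congr_ae ?_
    filter_upwards [hη.coeFn_toLp, hu.coeFn_toLp] with x h3 h4
    rw [h3, h4, RCLike.inner_apply, Complex.conj_ofReal, Complex.real_smul, mul_comm]
  have hDF : ∀ φ : T, D (F φ) =
      (∫ x, (fderiv ℝ φ.1 x (EuclideanSpace.single a 1)) • ψ (consConfig (x, y))) +
        ∫ x, φ.1 x • g (consConfig (x, y)) := fun φ => by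
    rw [hD]
    simp only [F]
    rw [hinner _ (hdL φ), hinner _ (hL φ)]
    rfl
  have hzero : ∀ φ : T, D (F φ) = 0 := fun φ₀ => by
    have hcl : IsClosed {p | D p = 0} := isClosed_eq hDc continuous_const
    refine hcl.closure_subset_iff.2 (fun p hp => ?_) (hcd (Set.mem_range_self φ₀))
    have h3 := hDF (φ ⟨p, hp⟩)
    rw [hφ ⟨p, hp⟩, hy ⟨p, hp⟩, neg_add_cancel] at h3
    exact h3
  refine ⟨h1.locallyIntegrable (by norm_num), h2.locallyIntegrable (by norm_num),
    fun η hη hηc => ?_⟩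
  have h3 := hDF ⟨η, hη, hηc⟩
  rw [hzero] at h3
  exact eq_neg_of_add_eq_zero_left h3.symm

/-! ### Permutation symmetry -/

section Symmetry

variable {N : ℕ}

lemma measurePreserving_comp_perm (σ : Equiv.Perm (Fin N)) :
    MeasurePreserving (fun (x : Config N) k => x (σ k)) volume volume ∧
      MeasurableEmbedding (fun (x : Config N) k => x (σ k)) := by
  have h : ⇑(MeasurableEquiv.piCongrLeft (fun _ : Fin N => Plane) σ.symm) =
      fun (x : Config N) k => x (σ k) := by
    funext x k
    have := MeasurableEquiv.piCongrLeft_apply_apply (β := fun _ : Fin N => Plane) σ.symm x (σ k)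
    simpa using this
  rw [← h]
  exact ⟨volume_measurePreserving_piCongrLeft (fun _ : Fin N => Plane) σ.symm,
    MeasurableEquiv.measurableEmbedding _⟩

lemma exists_perm_apply_eq {i j k l : Fin N} (hij : i ≠ j) (hkl : k ≠ l) :
    ∃ σ : Equiv.Perm (Fin N), σ i = k ∧ σ j = l := by
  refine ⟨Equiv.swap (Equiv.swap i k j) l * Equiv.swap i k, ?_, by simp⟩
  rw [Equiv.Perm.mul_apply, Equiv.swap_apply_left, Equiv.swap_apply_of_ne_of_ne _ hkl]
  exact fun h => hij ((Equiv.swap i k).injective (by rwa [Equiv.swap_apply_left]))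

/-- In a bosonic state all pairs of particles have the same distribution. -/
lemma IsBosonic.integral_pair_eq {ψ : Config N → ℂ} (hψ : IsBosonic ψ) (F : Plane → ℝ)
    {i j k l : Fin N} (hij : i ≠ j) (hkl : k ≠ l) :
    ∫ x, F (x i - x j) * ‖ψ x‖ ^ 2 = ∫ x, F (x k - x l) * ‖ψ x‖ ^ 2 := by
  obtain ⟨σ, rfl, rfl⟩ := exists_perm_apply_eq hij hkl
  obtain ⟨h1, h2⟩ := measurePreserving_comp_perm σ
  rw [← h1.integral_comp h2 (fun x : Config N => F (x i - x j) * ‖ψ x‖ ^ 2)]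
  refine integral_congr_ae ?_
  filter_upwards [hψ.symm σ] with x hx
  rw [hx]

lemma IsBosonic.weakDerivNormSq_le {ψ : Config N → ℂ} (hψ : IsBosonic ψ) (i j : Fin N)
    (a : Fin 2) : weakDerivNormSq ψ (coordDir i a) ≤ weakDerivNormSq ψ (coordDir j a) := by
  set P : Config N → Config N := fun x k => x (Equiv.swap i j k) with hP
  obtain ⟨h1, h2⟩ := measurePreserving_comp_perm (Equiv.swap i j)
  have hPP : ∀ x, P (P x) = x := fun x => by funext k; simp [hP]
  refine le_iInf fun g => le_iInf fun hg => le_iInf fun hw => ?_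
  have hgP : MemLp (g ∘ P) 2 volume := hg.comp_measurePreserving h1
  have hnorm : ∫⁻ x, ‖(g ∘ P) x‖ₑ ^ 2 = ∫⁻ x, ‖g x‖ₑ ^ 2 :=
    h1.lintegral_comp_emb h2 (fun x => ‖g x‖ₑ ^ 2)
  rw [← hnorm]
  refine iInf_le_of_le (g ∘ P) (iInf_le_of_le hgP (iInf_le_of_le ⟨hw.1,
    hgP.locallyIntegrable (by norm_num), fun φ hφ hφc => ?_⟩ le_rfl))
  let PL : Config N →L[ℝ] Config N := ContinuousLinearMap.pi fun k =>
    ContinuousLinearMap.proj (R := ℝ) (φ := fun _ : Fin N => Plane) (Equiv.swap i j k)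
  have hPL : ∀ x, PL x = P x := fun x => rfl
  have hφP : ContDiff ℝ ((⊤ : ℕ∞) : WithTop ℕ∞) (φ ∘ P) := hφ.comp PL.contDiff
  have hφPc : HasCompactSupport (φ ∘ P) := by
    have hPcont : Continuous P := PL.continuous
    exact hφc.comp_homeomorph ⟨⟨P, P, hPP, hPP⟩, hPcont, hPcont⟩
  have hdir : PL (coordDir j a) = coordDir i a := by
    rw [hPL]
    funext k
    simp only [hP, coordDir, Pi.single_apply]
    congr 1
    rw [Equiv.swap_apply_eq_iff, Equiv.swap_apply_right]
  have hder : ∀ x, fderiv ℝ (φ ∘ P) x (coordDir j a) = fderiv ℝ φ (P x) (coordDir i a) := by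
    intro x
    have : HasFDerivAt (φ ∘ P) ((fderiv ℝ φ (P x)).comp PL) x :=
      (hφ.differentiable (by simp) (P x)).hasFDerivAt.comp x PL.hasFDerivAt
    rw [this.fderiv, ContinuousLinearMap.comp_apply, hdir]
  have hkey := hw.2.2 _ hφP hφPc
  simp only [hder] at hkey
  rw [← h1.integral_comp h2 (fun x => (fderiv ℝ φ x) (coordDir i a) • ψ x),
    ← h1.integral_comp h2 (fun x => φ x • (g ∘ P) x)]
  have hR : ∀ x, (g ∘ P) (fun k => x (Equiv.swap i j k)) = g x := fun x => by
    rw [Function.comp_apply]; congr 1; exact hPP x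
  simp only [hR]
  refine Eq.trans (integral_congr_ae ?_) hkey
  filter_upwards [hψ.symm (Equiv.swap i j)] with x hx
  rw [hx]

/-- In a bosonic state all particles have the same one-body energy. -/
lemma IsBosonic.hermiteForm_eq {ψ : Config N → ℂ} (hψ : IsBosonic ψ) (ω : ℝ) (i j : Fin N) :
    hermiteForm ω i ψ = hermiteForm ω j ψ := by
  unfold hermiteForm
  congr 1
  · exact Finset.sum_congr rfl fun a _ =>
      le_antisymm (hψ.weakDerivNormSq_le i j a) (hψ.weakDerivNormSq_le j i a)
  · congr 1
    obtain ⟨h1, h2⟩ := measurePreserving_comp_perm (Equiv.swap i j)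
    rw [← h1.lintegral_comp_emb h2 (fun x : Config N => ‖x i‖ₑ ^ 2 * ‖ψ x‖ₑ ^ 2)]
    refine lintegral_congr_ae ?_
    filter_upwards [hψ.symm (Equiv.swap i j)] with x hx
    rw [hx, Equiv.swap_apply_left]

end Symmetry

lemma sum_sum_eq_of_diag {n : ℕ} {c : Fin n → Fin n → ℝ} {d w : ℝ} (hd : ∀ i, c i i = d)
    (hw : ∀ i j, i ≠ j → c i j = w) : ∑ i, ∑ j, c i j = n * d + n * (n - 1) * w := by
  have : ∀ i j, c i j = (if i = j then d - w else 0) + w := fun i j => by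
    split_ifs with h
    · rw [← h, hd]; ring
    · rw [hw i j h]; ring
  simp only [this, Finset.sum_add_distrib, Finset.sum_ite_eq, Finset.mem_univ, if_true,
    Finset.sum_const, Finset.card_univ, Fintype.card_fin, nsmul_eq_mul]
  ring

lemma sum_sum_Ioi_const (N : ℕ) (p : ℝ) :
    ∑ i : Fin N, ∑ _j ∈ Finset.Ioi i, p = N * (N - 1) / 2 * p := by
  have h := sum_sum_eq_of_diag (n := N) (c := fun i j => (if i < j then 1 else 0) +
    (if j < i then 1 else 0)) (d := 0) (w := 1) (by simp) (fun i j hij => by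
      rcases lt_or_gt_of_ne hij with h | h <;> simp [h, h.not_gt])
  simp only [Finset.sum_add_distrib] at h
  rw [Finset.sum_comm (f := fun i j : Fin N => if j < i then (1 : ℝ) else 0)] at h
  have h2 : ∀ i : Fin N, ∑ _j ∈ Finset.Ioi i, p = (∑ j : Fin N, if i < j then (1 : ℝ) else 0) * p :=
    fun i => by
      rw [Finset.sum_mul, ← Finset.filter_lt_eq_Ioi, Finset.sum_filter]
      simp
  simp only [h2, ← Finset.sum_mul]
  congr 1
  linarith

/-! ### The interaction energy in a bosonic state -/

/-- The sharp Gagliardo–Nirenberg inequality in terms of the density `‖f‖²`. -/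
lemma integral_density_sq_le (h0 : gnConst ≠ 0) {f : Plane → ℂ} (hf : MemLp f 2 volume)
    {g : Fin 2 → Plane → ℂ} (hg : ∀ a, MemLp (g a) 2 volume)
    (hw : ∀ a, HasWeakDeriv f (g a) (EuclideanSpace.single a 1)) :
    MemLp (fun x => ‖f x‖ ^ 2) 2 volume ∧
      ∫ x, (‖f x‖ ^ 2) ^ 2 ≤ gnConst ^ 4 * (∫ x, ‖f x‖ ^ 2) * ∑ a, ∫ x, ‖g a x‖ ^ 2 := by
  have hfin : ∀ {u : Plane → ℂ}, MemLp u 2 volume → ∫⁻ x, ‖u x‖ₑ ^ 2 ≠ ∞ := fun hu => by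
    rw [lintegral_enorm_sq_eq]
    exact ENNReal.pow_ne_top hu.eLpNorm_ne_top
  have hgrad : gradNormSq f ≤ ∑ a, ∫⁻ x, ‖g a x‖ₑ ^ 2 :=
    Finset.sum_le_sum fun a _ => iInf_le_of_le (g a) (iInf_le_of_le (hg a) (iInf_le _ (hw a)))
  have hGtop : ∑ a, ∫⁻ x, ‖g a x‖ₑ ^ 2 ≠ ∞ := ENNReal.sum_ne_top.2 fun a _ => hfin (hg a)
  have hGN := (lintegral_pow_four_le_of_gnConst_ne_zero h0 hf (hgrad.trans_lt hGtop.lt_top)).trans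
    (mul_le_mul_right hgrad _)
  have hRtop : ENNReal.ofReal (gnConst ^ 4) * (∫⁻ x, ‖f x‖ₑ ^ 2) * ∑ a, ∫⁻ x, ‖g a x‖ₑ ^ 2 ≠ ∞ :=
    ENNReal.mul_ne_top (ENNReal.mul_ne_top ENNReal.ofReal_ne_top (hfin hf)) hGtop
  have hmeas : AEStronglyMeasurable (fun x => ‖f x‖ ^ 2) volume := hf.1.norm.pow 2
  have hsq : ∫⁻ x, ‖‖f x‖ ^ 2‖ₑ ^ 2 = ∫⁻ x, ‖f x‖ₑ ^ 4 := by
    congr 1 with x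
    rw [enorm_pow, enorm_norm, ← pow_mul]
  have hmem : MemLp (fun x => ‖f x‖ ^ 2) 2 volume := by
    refine ⟨hmeas, ?_⟩
    have h4 := hGN.trans_lt hRtop.lt_top
    rw [← hsq, lintegral_enorm_sq_eq, ENNReal.pow_lt_top_iff] at h4
    exact h4.resolve_right (by norm_num)
  refine ⟨hmem, ?_⟩
  have hL : ∫ x, (‖f x‖ ^ 2) ^ 2 = (∫⁻ x, ‖f x‖ₑ ^ 4).toReal := by
    have := integral_norm_sq_eq hmeas
    rw [← lintegral_enorm_sq_eq, hsq] at this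
    simpa using this
  have hR := ENNReal.toReal_mono hRtop hGN
  rw [ENNReal.toReal_mul, ENNReal.toReal_mul, ENNReal.toReal_ofReal (by positivity),
    ENNReal.toReal_sum fun a _ => hfin (hg a)] at hR
  rw [hL, integral_norm_sq_eq hf.1, ← lintegral_enorm_sq_eq]
  simp only [integral_norm_sq_eq (hg _).1, ← lintegral_enorm_sq_eq]
  exact hR

lemma integrable_mul_cosTransform {X : Type*} [MeasurableSpace X] {μ : Measure X} {k : Plane → ℝ}
    (hk : Integrable k) {f : X → ℝ} (hf : Integrable f μ) {r : X → Plane} (hr : Measurable r) :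
    Integrable (fun x => cosTransform k (r x) * f x) μ :=
  hf.bdd_mul ((continuous_cosTransform hk).measurable.comp hr).aestronglyMeasurable
    (.of_forall fun x => abs_cosTransform_le hk (r x))

/-- For one particle in the field of fixed other particles: the attraction by a kernel of positive
type, corrected by the repulsion among the fixed particles, is controlled by the kinetic
energy. -/
lemma integral_slice_le (h0 : gnConst ≠ 0) {n : ℕ} {k : Plane → ℝ} (hk : Integrable k)
    (hk0 : ∀ v, 0 ≤ k v) {B : ℝ} (hkB : ∀ v, k v ≤ B) {l : ℝ} (hl : 0 < l) {f : Plane → ℂ}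
    (hf : MemLp f 2 volume) {g : Fin 2 → Plane → ℂ} (hg : ∀ a, MemLp (g a) 2 volume)
    (hw : ∀ a, HasWeakDeriv f (g a) (EuclideanSpace.single a 1)) (y : Config n) (t : ℝ) :
    ∫ x, (2 * t * (∑ j, cosTransform k (l • (x - y j))) -
        t ^ 2 * ∑ i, ∑ j, cosTransform k (l • (y i - y j))) * ‖f x‖ ^ 2 ≤
      B * gnConst ^ 4 * (l ^ 2)⁻¹ * ∑ a, ∫ x, ‖g a x‖ ^ 2 := by
  obtain ⟨hm, hle⟩ := integral_density_sq_le h0 hf hg hw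
  have hp : Integrable fun x => ‖f x‖ ^ 2 := (memLp_two_iff_integrable_sq_norm hf.1).1 hf
  have hB : 0 ≤ B := (hk0 0).trans (hkB 0)
  have hGnn : 0 ≤ ∑ a, ∫ x, ‖g a x‖ ^ 2 :=
    Finset.sum_nonneg fun a _ => integral_nonneg fun x => by positivity
  set A := ∫ x, ‖f x‖ ^ 2 with hA
  have hAnn : 0 ≤ A := integral_nonneg fun x => by positivity
  set Q := ∑ i, ∑ j, cosTransform k (l • (y i - y j)) with hQ
  have hpj : ∀ j, Integrable fun x => ‖f x‖ ^ 2 * cosTransform k (l • (x - y j)) := fun j => by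
    simpa only [mul_comm] using
      integrable_mul_cosTransform hk hp (r := fun x => l • (x - y j)) (by fun_prop)
  have hL : ∫ x, (2 * t * (∑ j, cosTransform k (l • (x - y j))) - t ^ 2 * Q) * ‖f x‖ ^ 2 =
      2 * t * ∑ j, (∫ x, ‖f x‖ ^ 2 * cosTransform k (l • (x - y j))) - t ^ 2 * Q * A := by
    rw [← integral_finsetSum _ fun j _ => hpj j, hA, ← integral_const_mul, ← integral_const_mul,
      ← integral_sub]
    · congr 1 with x
      rw [← Finset.mul_sum]
      ring
    · exact (integrable_finsetSum _ fun j _ => hpj j).const_mul _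
    · exact hp.const_mul _
  rw [hL]
  rcases hAnn.eq_or_lt with hA0 | hApos
  · have hae : (fun x => ‖f x‖ ^ 2) =ᵐ[volume] 0 :=
      (integral_eq_zero_iff_of_nonneg (fun x => by positivity) hp).1 hA0.symm
    have hz : ∀ j, ∫ x, ‖f x‖ ^ 2 * cosTransform k (l • (x - y j)) = 0 := fun j => by
      refine integral_eq_zero_of_ae ?_
      filter_upwards [hae] with x hx
      simp only [Pi.zero_apply] at hx ⊢
      rw [hx, zero_mul]
    simp only [hz, ← hA0]
    simp only [Finset.sum_const_zero, mul_zero, sub_zero]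
    positivity
  · have h := two_mul_sum_integral_sub_le hk hk0 hkB hp hm hl y (t * A)
    rw [finrank_euclideanSpace_fin, ← hQ] at h
    have h2 : B * ((l ^ 2)⁻¹ * ∫ x, (‖f x‖ ^ 2) ^ 2) ≤
        B * ((l ^ 2)⁻¹ * (gnConst ^ 4 * A * ∑ a, ∫ x, ‖g a x‖ ^ 2)) := by gcongr
    refine le_of_mul_le_mul_left ?_ hApos
    linarith

/-- A kernel of positive type has nonnegative total energy, up to the self-energies on the
diagonal. -/
lemma IsBosonic.neg_le_integral_pair {N : ℕ} {ψ : Config N → ℂ} (hψ : IsBosonic ψ)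
    {k : Plane → ℝ} (hk : Integrable k) (hk0 : ∀ v, 0 ≤ k v) (l : ℝ) {i j : Fin N} (hij : i ≠ j) :
    0 ≤ cosTransform k 0 * normSq ψ +
      (N - 1) * ∫ x, cosTransform k (l • (x i - x j)) * ‖ψ x‖ ^ 2 := by
  have hp : Integrable fun x => ‖ψ x‖ ^ 2 :=
    (memLp_two_iff_integrable_sq_norm hψ.memLp.1).1 hψ.memLp
  have hint : ∀ a b : Fin N,
      Integrable fun x : Config N => cosTransform k (l • (x a - x b)) * ‖ψ x‖ ^ 2 := fun a b =>
    integrable_mul_cosTransform hk hp (r := fun x : Config N => l • (x a - x b)) (by fun_prop)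
  have hpos : 0 ≤ ∫ x : Config N,
      (∑ a, ∑ b, cosTransform k (l • (x a - x b))) * ‖ψ x‖ ^ 2 := by
    refine integral_nonneg fun x => mul_nonneg ?_ (by positivity)
    simpa only [smul_sub] using sum_sum_cosTransform_nonneg hk hk0 fun a => l • x a
  have hsum : ∫ x : Config N, (∑ a, ∑ b, cosTransform k (l • (x a - x b))) * ‖ψ x‖ ^ 2 =
      ∑ a, ∑ b, ∫ x : Config N, cosTransform k (l • (x a - x b)) * ‖ψ x‖ ^ 2 := by
    simp only [Finset.sum_mul]
    rw [integral_finsetSum _ fun a _ => integrable_finsetSum _ fun b _ => hint a b]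
    exact Finset.sum_congr rfl fun a _ => integral_finsetSum _ fun b _ => hint a b
  rw [hsum, sum_sum_eq_of_diag (d := cosTransform k 0 * normSq ψ)
    (w := ∫ x, cosTransform k (l • (x i - x j)) * ‖ψ x‖ ^ 2)
    (fun a => by simp only [sub_self, smul_zero, integral_const_mul, normSq])
    (fun a b hab => hψ.integral_pair_eq (fun z => cosTransform k (l • z)) hab hij)] at hpos
  have hN : (0 : ℝ) < N := by exact_mod_cast Fin.pos i
  refine nonneg_of_mul_nonneg_right ?_ hN
  linarith

/-- The self-consistent upper bound: the attraction by a kernel of positive type is controlled by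
the kinetic energy of one particle and the self-energy of the kernel. The other particles serve as
a fixed cloud, and bosonic symmetry identifies the repulsion within the cloud with the attraction
itself. -/
lemma IsBosonic.integral_pair_le (h0 : gnConst ≠ 0) {n : ℕ} (hn : n ≠ 0) {ψ : Config (n + 1) → ℂ}
    (hψ : IsBosonic ψ) {k : Plane → ℝ} (hk : Integrable k) (hk0 : ∀ v, 0 ≤ k v) {B : ℝ}
    (hkB : ∀ v, k v ≤ B) {l : ℝ} (hl : 0 < l) {g : Fin 2 → Config (n + 1) → ℂ}
    (hg : ∀ a, MemLp (g a) 2 volume) (hw : ∀ a, HasWeakDeriv ψ (g a) (coordDir 0 a))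
    {i j : Fin (n + 1)} (hij : i ≠ j) :
    ∫ x, cosTransform k (l • (x i - x j)) * ‖ψ x‖ ^ 2 ≤
      B * gnConst ^ 4 * (l ^ 2)⁻¹ * (∑ a, ∫ x, ‖g a x‖ ^ 2) + cosTransform k 0 * normSq ψ / n := by
  set w := ∫ x, cosTransform k (l • (x i - x j)) * ‖ψ x‖ ^ 2 with hwdef
  have hB : 0 ≤ B := (hk0 0).trans (hkB 0)
  have hn0 : (0 : ℝ) < n := by exact_mod_cast Nat.pos_of_ne_zero hn
  have hp : Integrable fun x => ‖ψ x‖ ^ 2 :=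
    (memLp_two_iff_integrable_sq_norm hψ.memLp.1).1 hψ.memLp
  have hgp : ∀ a, Integrable fun x => ‖g a x‖ ^ 2 := fun a =>
    (memLp_two_iff_integrable_sq_norm (hg a).1).1 (hg a)
  have hint : ∀ a b : Fin (n + 1),
      Integrable fun x : Config (n + 1) => cosTransform k (l • (x a - x b)) * ‖ψ x‖ ^ 2 :=
    fun a b => integrable_mul_cosTransform hk hp
      (r := fun x : Config (n + 1) => l • (x a - x b)) (by fun_prop)
  have hpair : ∀ a b : Fin (n + 1), a ≠ b →
      ∫ x, cosTransform k (l • (x a - x b)) * ‖ψ x‖ ^ 2 = w := fun a b hab =>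
    hψ.integral_pair_eq (fun z => cosTransform k (l • z)) hab hij
  -- `H` is the attraction of the first particle by the others minus the repulsion among the
  -- others; the weights `2 / n` and `1 / n²` come from completing the square
  set t : ℝ := (n : ℝ)⁻¹ with ht
  set H : Config (n + 1) → ℝ := fun x =>
    2 * t * (∑ b : Fin n, cosTransform k (l • (x 0 - x b.succ))) -
      t ^ 2 * ∑ a : Fin n, ∑ b : Fin n, cosTransform k (l • (x a.succ - x b.succ)) with hH
  have e1 : ∀ x, H x * ‖ψ x‖ ^ 2 =
      2 * t * (∑ b : Fin n, cosTransform k (l • (x 0 - x b.succ)) * ‖ψ x‖ ^ 2) -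
      t ^ 2 * ∑ a : Fin n, ∑ b : Fin n,
        cosTransform k (l • (x a.succ - x b.succ)) * ‖ψ x‖ ^ 2 := fun x => by
    simp only [hH, ← Finset.sum_mul]
    ring
  have i1 : Integrable fun x : Config (n + 1) =>
      ∑ b : Fin n, cosTransform k (l • (x 0 - x b.succ)) * ‖ψ x‖ ^ 2 :=
    integrable_finsetSum _ fun b _ => hint 0 b.succ
  have i2 : Integrable fun x : Config (n + 1) => ∑ a : Fin n, ∑ b : Fin n,
      cosTransform k (l • (x a.succ - x b.succ)) * ‖ψ x‖ ^ 2 :=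
    integrable_finsetSum _ fun a _ => integrable_finsetSum _ fun b _ => hint a.succ b.succ
  have hHint : Integrable fun x => H x * ‖ψ x‖ ^ 2 := by
    simp only [e1]
    exact (i1.const_mul _).sub (i2.const_mul _)
  have hHval : ∫ x, H x * ‖ψ x‖ ^ 2 =
      2 * t * (n * w) - t ^ 2 * (n * (cosTransform k 0 * normSq ψ) + n * (n - 1) * w) := by
    simp only [e1]
    rw [integral_sub (i1.const_mul _) (i2.const_mul _), integral_const_mul, integral_const_mul,
      integral_finsetSum _ fun b _ => hint 0 b.succ,
      integral_finsetSum _ fun a _ => integrable_finsetSum _ fun b _ => hint a.succ b.succ]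
    congr 2
    · rw [Finset.sum_congr rfl fun b _ => hpair 0 b.succ (Fin.succ_ne_zero b).symm]
      simp
    · rw [Finset.sum_congr rfl fun a _ => integral_finsetSum _ fun b _ => hint a.succ b.succ]
      refine sum_sum_eq_of_diag (fun a => ?_) fun a b hab => hpair _ _ (by simpa using hab)
      simp only [sub_self, smul_zero, integral_const_mul, normSq]
  have hHle : ∫ x, H x * ‖ψ x‖ ^ 2 ≤
      B * gnConst ^ 4 * (l ^ 2)⁻¹ * ∑ a, ∫ x, ‖g a x‖ ^ 2 := by
    have mp := measurePreserving_consConfig (n := n)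
    have me := measurableEmbedding_consConfig (n := n)
    have hHint' : Integrable (fun z => H (consConfig z) * ‖ψ (consConfig z)‖ ^ 2)
        (volume.prod volume) := (mp.integrable_comp_emb me).2 hHint
    have hgp' : ∀ a, Integrable (fun z => ‖g a (consConfig z)‖ ^ 2) (volume.prod volume) :=
      fun a => (mp.integrable_comp_emb me).2 (hgp a)
    have hrhs : ∑ a, ∫ x, ‖g a x‖ ^ 2 =
        ∫ y : Config n, ∑ a, ∫ x, ‖g a (consConfig (x, y))‖ ^ 2 := by
      rw [integral_finsetSum _ fun a _ => (hgp' a).integral_prod_right]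
      refine Finset.sum_congr rfl fun a _ => ?_
      rw [← mp.integral_comp me (fun x => ‖g a x‖ ^ 2), integral_prod_symm _ (hgp' a)]
    rw [← mp.integral_comp me (fun x => H x * ‖ψ x‖ ^ 2), integral_prod_symm _ hHint', hrhs,
      ← integral_const_mul]
    refine integral_mono_ae hHint'.integral_prod_right
      ((integrable_finsetSum _ fun a _ => (hgp' a).integral_prod_right).const_mul _) ?_
    filter_upwards [ae_memLp_two_slice (hψ.memLp.comp_measurePreserving mp),
      ae_all_iff.2 fun a => ae_memLp_two_slice ((hg a).comp_measurePreserving mp),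
      ae_all_iff.2 fun a => ae_hasWeakDeriv_slice hψ.memLp (hg a) (hw a)] with y h1 h2 h3
    exact integral_slice_le h0 hk hk0 hkB hl h1 h2 h3 y t
  rw [hHval] at hHle
  have hM : 0 ≤ cosTransform k 0 := by
    simp only [cosTransform, inner_zero_right, mul_zero, Real.cos_zero, mul_one]
    exact integral_nonneg hk0
  have hnorm : 0 ≤ normSq ψ := integral_nonneg fun x => by positivity
  have hT : 0 ≤ B * gnConst ^ 4 * (l ^ 2)⁻¹ * ∑ a, ∫ x, ‖g a x‖ ^ 2 :=
    mul_nonneg (by positivity) (Finset.sum_nonneg fun a _ => integral_nonneg fun x => by positivity)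
  have hid : 2 * t * (n * w) - t ^ 2 * (n * (cosTransform k 0 * normSq ψ) + n * (n - 1) * w) =
      (1 + t) * w - cosTransform k 0 * normSq ψ / n := by
    rw [ht]
    field_simp
    ring
  rw [hid] at hHle
  have ht0 : 0 < t := inv_pos.2 hn0
  have hSn : 0 ≤ cosTransform k 0 * normSq ψ / n := by positivity
  by_contra! hlt
  nlinarith [mul_pos ht0 (lt_of_le_of_lt (add_nonneg hT hSn) hlt)]

/-- The constant in the error term: self-energies of the potential and of the kernel whose Fourier
transform is `|V̂|`. -/
noncomputable def selfEnergy (V : SchwartzMap Plane ℝ) : ℝ :=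
  |V 0| + 2 * ∫ v, ‖FourierTransform.fourier (complexify V) v‖

lemma selfEnergy_nonneg (V : SchwartzMap Plane ℝ) : 0 ≤ selfEnergy V :=
  add_nonneg (abs_nonneg _) (mul_nonneg zero_le_two (integral_nonneg fun _ => norm_nonneg _))

/-- Lower bound on the interaction energy by the kinetic energy along the first particle. The
potential is written as the difference of two kernels of positive type, with Fourier transforms
`Re V̂ + |V̂|` and `|V̂|`; the second one is bounded by `‖V‖_{L¹}`. -/
lemma IsBosonic.neg_le_pairForm (h0 : gnConst ≠ 0) {V : SchwartzMap Plane ℝ}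
    (hV : ∀ y, V (-y) = V y) {n : ℕ} (hn : n ≠ 0) {ψ : Config (n + 1) → ℂ} (hψ : IsBosonic ψ)
    (β : ℝ) {g : Fin 2 → Config (n + 1) → ℂ} (hg : ∀ a, MemLp (g a) 2 volume)
    (hw : ∀ a, HasWeakDeriv ψ (g a) (coordDir 0 a)) {i j : Fin (n + 1)} (hij : i ≠ j) :
    -((∫ y, |V y|) * gnConst ^ 4 * (∑ a, ∫ x, ‖g a x‖ ^ 2) +
        ((n + 1 : ℕ) : ℝ) ^ (2 * β) * selfEnergy V / n * normSq ψ) ≤ pairForm β V i j ψ := by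
  set l : ℝ := ((n + 1 : ℕ) : ℝ) ^ β with hl
  have hl0 : 0 < l := Real.rpow_pos_of_pos (by positivity) _
  have hl2 : ((n + 1 : ℕ) : ℝ) ^ (2 * β) = l ^ 2 := by
    rw [hl, ← Real.rpow_natCast, ← Real.rpow_mul (by positivity), mul_comm]
    norm_num
  set k₀ : Plane → ℂ := fun v => FourierTransform.fourier (complexify V) v with hk₀
  have hk₀i : Integrable k₀ := (FourierTransform.fourier (complexify V)).integrable
  set k : Plane → ℝ := fun v => ‖k₀ v‖ with hk
  set r : Plane → ℝ := fun v => (k₀ v).re with hr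
  have hki : Integrable k := hk₀i.norm
  have hri : Integrable r := hk₀i.re
  have hp : Integrable fun x => ‖ψ x‖ ^ 2 :=
    (memLp_two_iff_integrable_sq_norm hψ.memLp.1).1 hψ.memLp
  have hcos : ∀ y, cosTransform (r + k) y = V y + cosTransform k y := fun y => by
    rw [← cosTransform_re_fourier hV y, cosTransform, cosTransform, cosTransform,
      ← integral_add (integrable_mul_cos hri y) (integrable_mul_cos hki y)]
    simp only [Pi.add_apply, add_mul]
  have hk00 : cosTransform k 0 = ∫ v, k v := by simp [cosTransform]
  set v := ∫ x : Config (n + 1), V (l • (x i - x j)) * ‖ψ x‖ ^ 2 with hv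
  set w := ∫ x : Config (n + 1), cosTransform k (l • (x i - x j)) * ‖ψ x‖ ^ 2 with hwd
  have hlow := hψ.neg_le_integral_pair (hri.add hki) (fun v => by
    have := abs_le.1 (Complex.abs_re_le_norm (k₀ v))
    simp only [Pi.add_apply, hr, hk]
    linarith) l hij
  have hsplit : ∫ x, cosTransform (r + k) (l • (x i - x j)) * ‖ψ x‖ ^ 2 = v + w := by
    rw [hv, hwd, ← integral_add]
    · simp only [hcos, add_mul]
    · have := integrable_mul_cosTransform hri hp (r := fun x => l • (x i - x j)) (by fun_prop)
      refine this.congr (.of_forall fun x => ?_)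
      simp only [hr, hk₀, cosTransform_re_fourier hV]
    · exact integrable_mul_cosTransform hki hp (r := fun x => l • (x i - x j)) (by fun_prop)
  have hup := hψ.integral_pair_le h0 hn hki (fun v => norm_nonneg _)
    (norm_fourier_complexify_le V) hl0 hg hw hij
  rw [← hwd] at hup
  rw [hsplit, hcos] at hlow
  have hpf : pairForm β V i j ψ = l ^ 2 * v := by
    rw [pairForm, hv, ← integral_const_mul]
    simp only [scaledPotential, hl2, ← hl, mul_assoc]
  set T := ∑ a, ∫ x, ‖g a x‖ ^ 2 with hT
  set M := normSq ψ with hM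
  have hMnn : 0 ≤ M := integral_nonneg fun x => by positivity
  have hn0 : (0 : ℝ) < n := by exact_mod_cast Nat.pos_of_ne_zero hn
  have hself : selfEnergy V = |V 0| + 2 * cosTransform k 0 := by rw [hk00]; rfl
  rw [hpf, hl2, hself]
  have hlow' : -((V 0 + cosTransform k 0) * M / n) ≤ v + w := by
    rw [neg_le_iff_add_nonneg, ← sub_nonneg]
    have : v + w + (V 0 + cosTransform k 0) * M / n =
      ((V 0 + cosTransform k 0) * M + ((n + 1 : ℕ) - 1 : ℝ) * (v + w)) / n := by
      push_cast
      field_simp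
      ring
    rw [this, sub_zero]
    exact div_nonneg hlow hn0.le
  have hVabs : V 0 * M / n ≤ |V 0| * M / n := by
    gcongr
    exact le_abs_self _
  have hl2pos : 0 < l ^ 2 := by positivity
  have hfinal : -((∫ y, |V y|) * gnConst ^ 4 * (l ^ 2)⁻¹ * T +
      (|V 0| + 2 * cosTransform k 0) / n * M) ≤ v := by
    have e1 : (V 0 + cosTransform k 0) * M / n = V 0 * M / n + cosTransform k 0 * M / n := by ring
    have e2 : (|V 0| + 2 * cosTransform k 0) / n * M =
      |V 0| * M / n + 2 * (cosTransform k 0 * M / n) := by ring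
    rw [e1] at hlow'
    rw [e2]
    linarith
  have := mul_le_mul_of_nonneg_left hfinal hl2pos.le
  refine le_trans (le_of_eq ?_) this
  field_simp

/-! ### Stability of matter -/

lemma exists_weakDeriv_integral_le {N : ℕ} {ψ : Config N → ℂ} {v : Config N}
    (h : weakDerivNormSq ψ v ≠ ∞) {ε : ℝ} (hε : 0 < ε) :
    ∃ g : Config N → ℂ, MemLp g 2 volume ∧ HasWeakDeriv ψ g v ∧
      ∫ x, ‖g x‖ ^ 2 ≤ (weakDerivNormSq ψ v).toReal + ε := by
  have hlt : weakDerivNormSq ψ v < weakDerivNormSq ψ v + ENNReal.ofReal ε :=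
    ENNReal.lt_add_right h (by simpa using hε)
  rw [weakDerivNormSq] at hlt
  simp only [iInf_lt_iff] at hlt
  obtain ⟨g, hg, hw, hle⟩ := hlt
  refine ⟨g, hg, hw, ?_⟩
  have h1 := ENNReal.toReal_mono (ENNReal.add_ne_top.2 ⟨h, ENNReal.ofReal_ne_top⟩) hle.le
  rwa [ENNReal.toReal_add h ENNReal.ofReal_ne_top, ENNReal.toReal_ofReal hε.le,
    lintegral_enorm_sq_eq, ← integral_norm_sq_eq hg.1] at h1

/-- The interaction energy is controlled by the one-body energy, up to an error that vanishes as
the particle number grows (for `β < 1 / 2`). -/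
lemma IsBosonic.neg_le_pairForm_hermiteForm (h0 : gnConst ≠ 0) {V : SchwartzMap Plane ℝ}
    (hV : ∀ y, V (-y) = V y) {N : ℕ} {ψ : Config N → ℂ} (hψ : IsBosonic ψ) (ω β : ℝ)
    {i j : Fin N} (hij : i ≠ j) (hfin : hermiteForm ω i ψ ≠ ∞) :
    -((∫ y, |V y|) * gnConst ^ 4 * (hermiteForm ω i ψ).toReal +
        (N : ℝ) ^ (2 * β) * selfEnergy V / ((N : ℝ) - 1) * normSq ψ) ≤ pairForm β V i j ψ := by
  obtain _ | n := N
  · exact i.elim0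
  have hn : n ≠ 0 := by
    rintro rfl
    exact hij (Subsingleton.elim (α := Fin 1) i j)
  rw [hψ.hermiteForm_eq ω i 0] at hfin ⊢
  have hcast : ((n + 1 : ℕ) : ℝ) - 1 = n := by push_cast; ring
  rw [hcast]
  set B := (∫ y, |V y|) * gnConst ^ 4 with hB
  have hB0 : 0 ≤ B := mul_nonneg (integral_nonneg fun y => abs_nonneg _) (by positivity)
  have hkin : ∑ a : Fin 2, weakDerivNormSq ψ (coordDir 0 a) ≠ ∞ :=
    ne_top_of_le_ne_top hfin le_self_add
  have hkin' : ∀ a : Fin 2, weakDerivNormSq ψ (coordDir 0 a) ≠ ∞ := fun a =>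
    ENNReal.sum_ne_top.1 hkin a (Finset.mem_univ a)
  refine le_of_forall_pos_le_add fun ε hε => ?_
  -- an almost minimizing pair of weak derivatives
  have hδ : 0 < ε / (2 * (B + 1)) := by positivity
  choose g hg hw hle using fun a => exists_weakDeriv_integral_le (hkin' a) hδ
  have hmain := hψ.neg_le_pairForm h0 hV hn β hg hw hij
  have hT : ∑ a, ∫ x, ‖g a x‖ ^ 2 ≤ (hermiteForm ω 0 ψ).toReal + ε / (B + 1) := by
    have h1 : ∑ a, ∫ x, ‖g a x‖ ^ 2 ≤
        ∑ a : Fin 2, ((weakDerivNormSq ψ (coordDir 0 a)).toReal + ε / (2 * (B + 1))) :=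
      Finset.sum_le_sum fun a _ => hle a
    have h2 : ∑ a : Fin 2, (weakDerivNormSq ψ (coordDir 0 a)).toReal ≤
        (hermiteForm ω 0 ψ).toReal := by
      rw [← ENNReal.toReal_sum fun a _ => hkin' a]
      exact ENNReal.toReal_mono hfin le_self_add
    rw [Finset.sum_add_distrib] at h1
    simp only [Finset.sum_const, Finset.card_univ, Fintype.card_fin, nsmul_eq_mul] at h1
    have h3 : ((2 : ℕ) : ℝ) * (ε / (2 * (B + 1))) = ε / (B + 1) := by
      push_cast
      field_simp
    linarith
  have hBT := mul_le_mul_of_nonneg_left hT hB0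
  have hBε : B * (ε / (B + 1)) ≤ ε := by
    rw [mul_div_assoc', div_le_iff₀ (by positivity)]
    nlinarith
  rw [← hB] at hmain
  linarith

lemma tendsto_error {β : ℝ} (hβ : β < 1 / 2) (K : ℝ) :
    Filter.Tendsto (fun N : ℕ => (N : ℝ) ^ (2 * β) * K / ((N : ℝ) - 1)) Filter.atTop (nhds 0) := by
  have h1 : Filter.Tendsto (fun N : ℕ => (N : ℝ) ^ (-(1 - 2 * β))) Filter.atTop (nhds 0) :=
    (tendsto_rpow_neg_atTop (by linarith)).comp tendsto_natCast_atTop_atTop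
  have h2 : Filter.Tendsto (fun N : ℕ => 1 - (N : ℝ)⁻¹) Filter.atTop (nhds (1 - 0)) :=
    tendsto_const_nhds.sub tendsto_inv_atTop_nhds_zero_nat
  have h3 := ((h1.mul_const K).div h2 (by norm_num))
  rw [zero_mul, zero_div] at h3
  refine h3.congr' ?_
  filter_upwards [Filter.eventually_gt_atTop 1] with N hN
  have hN0 : (0 : ℝ) < N := by positivity
  have hN1 : (0 : ℝ) < N - 1 := by
    have : (1 : ℝ) < N := by exact_mod_cast hN
    linarith
  have hN2 : 1 - (N : ℝ)⁻¹ = (N - 1) / N := by field_simp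
  simp only [Pi.div_apply]
  rw [hN2, neg_sub, Real.rpow_sub hN0, Real.rpow_one]
  field_simp

lemma sum_hermiteForm_eq {N : ℕ} {ψ : Config N → ℂ} (hψ : IsBosonic ψ) (ω : ℝ) (i : Fin N) :
    ∑ j, hermiteForm ω j ψ = N * hermiteForm ω i ψ := by
  rw [Finset.sum_congr rfl fun j _ => hψ.hermiteForm_eq ω j i]
  simp

lemma IsBosonic.sum_pairForm_eq {N : ℕ} {ψ : Config N → ℂ} (hψ : IsBosonic ψ) (β : ℝ)
    (V : SchwartzMap Plane ℝ) {i j : Fin N} (hij : i ≠ j) :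
    ∑ k : Fin N, ∑ l ∈ Finset.Ioi k, pairForm β V k l ψ = N * (N - 1) / 2 * pairForm β V i j ψ := by
  rw [← sum_sum_Ioi_const]
  exact Finset.sum_congr rfl fun k _ => Finset.sum_congr rfl fun l hl =>
    hψ.integral_pair_eq (scaledPotential β N V) (Finset.mem_Ioi.1 hl).ne hij

/-- Both energy estimates, as soon as the error term is at most `2 C₀`. -/
lemma IsBosonic.energy_estimates (h0 : gnConst ≠ 0) {V : SchwartzMap Plane ℝ}
    (hV : ∀ y, V (-y) = V y) {α : ℝ} (hVα : (∫ y, |V y|) * gnConst ^ 4 ≤ 2 * α)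
    (ω β : ℝ) {C₀ : ℝ} {N : ℕ}
    (herr : (N : ℝ) ^ (2 * β) * selfEnergy V / ((N : ℝ) - 1) ≤ 2 * C₀)
    {ψ : Config N → ℂ} (hψ : IsBosonic ψ) {i j : Fin N} (hij : i ≠ j) :
    ((1 - α : ℝ) : EReal) * (hermiteForm ω i ψ : EReal) ≤
        (((N : ℝ)⁻¹ : ℝ) : EReal) * energy ω β V ψ + ((C₀ * normSq ψ : ℝ) : EReal) ∧
      ((2 * (1 - α) : ℝ) : EReal) * (hermiteForm ω i ψ : EReal) ≤
        ((2 * C₀ * normSq ψ : ℝ) : EReal) + twoBodyEnergy ω β V i j ψ := by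
  have hN : 0 < N := Fin.pos i
  have hN0 : (0 : ℝ) < N := by exact_mod_cast hN
  have hN1 : (1 : ℝ) ≤ N := by exact_mod_cast hN
  unfold energy twoBodyEnergy
  rw [sum_hermiteForm_eq hψ ω i, hψ.sum_pairForm_eq β V hij, hψ.hermiteForm_eq ω j i]
  by_cases hfin : hermiteForm ω i ψ = ∞
  -- off the form domain both right-hand sides are `∞`
  · have hNne : ((N : ℝ≥0∞)) ≠ 0 := by exact_mod_cast hN.ne'
    rw [hfin, ENNReal.mul_top hNne, top_add, EReal.coe_ennreal_top, EReal.top_add_coe,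
      EReal.top_add_coe, EReal.coe_mul_top_of_pos (inv_pos.2 hN0), EReal.top_add_coe,
      EReal.coe_add_top]
    exact ⟨le_top, le_top⟩
  · have hp := hψ.neg_le_pairForm_hermiteForm h0 hV ω β hij hfin
    set h := (hermiteForm ω i ψ).toReal with hh
    have hh0 : 0 ≤ h := ENNReal.toReal_nonneg
    have hcoe : hermiteForm ω i ψ = ENNReal.ofReal h := (ENNReal.ofReal_toReal hfin).symm
    have hM : 0 ≤ normSq ψ := integral_nonneg fun x => by positivity
    have hp' : -(2 * α * h + 2 * C₀ * normSq ψ) ≤ pairForm β V i j ψ := by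
      have h1 := mul_le_mul_of_nonneg_right hVα hh0
      have h2 := mul_le_mul_of_nonneg_right herr hM
      linarith
    have hnn : 0 ≤ 2 * α * h + 2 * C₀ * normSq ψ := by
      refine add_nonneg (mul_nonneg (le_trans ?_ hVα) hh0) (mul_nonneg (le_trans ?_ herr) hM)
      · exact mul_nonneg (integral_nonneg fun y => abs_nonneg _) (by positivity)
      · exact div_nonneg (mul_nonneg (by positivity) (selfEnergy_nonneg V)) (by linarith)
    have hκ : -(2 * α * h + 2 * C₀ * normSq ψ) ≤ ((N : ℝ) - 1) / N * pairForm β V i j ψ := by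
      have hκ0 : 0 ≤ ((N : ℝ) - 1) / N := div_nonneg (by linarith) hN0.le
      have hκ1 : ((N : ℝ) - 1) / N ≤ 1 := (div_le_one hN0).2 (by linarith)
      have := mul_le_mul_of_nonneg_left hp' hκ0
      nlinarith
    have hNh : (N : ℝ≥0∞) * ENNReal.ofReal h = ENNReal.ofReal (N * h) := by
      rw [ENNReal.ofReal_mul hN0.le, ENNReal.ofReal_natCast]
    rw [hcoe, hNh, ← ENNReal.ofReal_add hh0 hh0, EReal.coe_ennreal_ofReal,
      EReal.coe_ennreal_ofReal, EReal.coe_ennreal_ofReal, max_eq_left hh0,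
      max_eq_left (by positivity), max_eq_left (by positivity)]
    simp only [← EReal.coe_mul, ← EReal.coe_add, EReal.coe_le_coe_iff]
    constructor
    · have hid : (N : ℝ)⁻¹ * (N * h + (N : ℝ)⁻¹ * (N * (N - 1) / 2 * pairForm β V i j ψ)) =
          h + ((N : ℝ) - 1) / N * pairForm β V i j ψ / 2 := by
        field_simp
      rw [hid]
      linarith
    · linarith

/-- The energy estimate implies stability. -/
lemma neg_le_energy_of_le {N : ℕ} (hN : 0 < N) {α ω β C₀ : ℝ} (hα : α ≤ 1)
    {V : SchwartzMap Plane ℝ} {ψ : Config N → ℂ} {i : Fin N}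
    (h : ((1 - α : ℝ) : EReal) * (hermiteForm ω i ψ : EReal) ≤
      (((N : ℝ)⁻¹ : ℝ) : EReal) * energy ω β V ψ + ((C₀ * normSq ψ : ℝ) : EReal)) :
    ((-(C₀ * N * normSq ψ) : ℝ) : EReal) ≤ energy ω β V ψ := by
  have hN0 : (0 : ℝ) < N := by exact_mod_cast hN
  have hpos : (0 : EReal) ≤ ((1 - α : ℝ) : EReal) * (hermiteForm ω i ψ : EReal) :=
    mul_nonneg (by exact_mod_cast sub_nonneg.2 hα) (EReal.coe_ennreal_nonneg _)
  have h1 := hpos.trans h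
  induction hE : energy ω β V ψ with
  | top => exact le_top
  | bot =>
    rw [hE, EReal.coe_mul_bot_of_pos (inv_pos.2 hN0), EReal.bot_add] at h1
    exact absurd h1 (by simp)
  | coe e =>
    rw [hE] at h1
    norm_cast at h1 ⊢
    have h2 := mul_le_mul_of_nonneg_left h1 hN0.le
    rw [mul_add, ← mul_assoc, mul_inv_cancel₀ hN0.ne'] at h2
    linarith

end ManyBody

theorem theorem4 (ω β α : ℝ) (hω : 0 < ω) (hβ : β < 1 / 6) (hα : α ∈ Set.Ioo (0 : ℝ) 1)
    (V : SchwartzMap ManyBody.Plane ℝ) (hVeven : ∀ y, V (-y) = V y)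
    (hV : ∫ y, |V y| < 2 * α / ManyBody.gnConst ^ 4) :
    -- the energy estimate and its two-body form, with a threshold that depends on `C₀`
    (∃ N₀ : ℝ → ℕ, Filter.Tendsto N₀ (nhdsWithin 0 (Set.Ioi 0)) Filter.atTop ∧
      ∀ C₀ : ℝ, 0 < C₀ → ∀ N : ℕ, N₀ C₀ < N →
        ∀ ψ : ManyBody.Config N → ℂ, ManyBody.IsBosonic ψ →
          (∀ i : Fin N,
            ((1 - α : ℝ) : EReal) * (ManyBody.hermiteForm ω i ψ : EReal) ≤
              (((N : ℝ)⁻¹ : ℝ) : EReal) * ManyBody.energy ω β V ψ +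
                ((C₀ * ManyBody.normSq ψ : ℝ) : EReal)) ∧
          (∀ i j : Fin N, i ≠ j →
            ((2 * (1 - α) : ℝ) : EReal) * (ManyBody.hermiteForm ω i ψ : EReal) ≤
              ((2 * C₀ * ManyBody.normSq ψ : ℝ) : EReal) +
                ManyBody.twoBodyEnergy ω β V i j ψ)) ∧
    -- stability of the `N`-body system beyond a threshold
    (∃ (C : ℝ) (N₁ : ℕ), ∀ N : ℕ, N₁ < N →
      ∀ ψ : ManyBody.Config N → ℂ, ManyBody.IsBosonic ψ →
        ((-(C * N * ManyBody.normSq ψ) : ℝ) : EReal) ≤ ManyBody.energy ω β V ψ) := by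
  have hα0 := hα.1
  -- `x / 0 = 0` rules out `gnConst = 0`, so the Gagliardo–Nirenberg constant is a genuine one
  have h0 : ManyBody.gnConst ≠ 0 := by
    intro h
    rw [h] at hV
    have : 0 ≤ ∫ y, |V y| := integral_nonneg fun y => abs_nonneg _
    simp only [ne_eq, OfNat.ofNat_ne_zero, not_false_eq_true, zero_pow, div_zero] at hV
    linarith
  have hVα : (∫ y, |V y|) * ManyBody.gnConst ^ 4 ≤ 2 * α :=
    ((lt_div_iff₀ (by positivity)).1 hV).le
  have herr := ManyBody.tendsto_error (β := β) (by linarith) (ManyBody.selfEnergy V)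
  have hex : ∀ C₀ : ℝ, ∃ M : ℕ, 0 < C₀ → ∀ N : ℕ, M ≤ N →
      (N : ℝ) ^ (2 * β) * ManyBody.selfEnergy V / ((N : ℝ) - 1) ≤ 2 * C₀ := fun C₀ => by
    by_cases hC : 0 < C₀
    · obtain ⟨M, hM⟩ := Filter.eventually_atTop.1 (herr.eventually_le_const (u := 2 * C₀)
        (by linarith))
      exact ⟨M, fun _ N hN => hM N hN⟩
    · exact ⟨0, fun h => absurd h hC⟩
  choose M hM using hex
  have hest : ∀ C₀ : ℝ, 0 < C₀ → ∀ N : ℕ, max (M C₀) 1 < N →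
      ∀ ψ : ManyBody.Config N → ℂ, ManyBody.IsBosonic ψ → ∀ i j : Fin N, i ≠ j → _ :=
    fun C₀ hC N hN ψ hψ i j hij => ManyBody.IsBosonic.energy_estimates h0 hVeven hVα ω β
      (hM C₀ hC N ((le_max_left _ _).trans hN.le)) hψ hij
  have hother : ∀ N : ℕ, 1 < N → ∀ i : Fin N, ∃ j, i ≠ j := fun N hN i => by
    have : Nontrivial (Fin N) := Fin.nontrivial_iff_two_le.2 hN
    obtain ⟨j, hj⟩ := exists_ne i
    exact ⟨j, hj.symm⟩
  refine ⟨⟨fun C₀ => max (max (M C₀) 1) ⌈C₀⁻¹⌉₊, ?_, fun C₀ hC N hN ψ hψ => ?_⟩,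
    1, max (M 1) 1, fun N hN ψ hψ => ?_⟩
  · exact Filter.tendsto_atTop_mono (fun C₀ => le_max_right _ _)
      (tendsto_nat_ceil_atTop.comp tendsto_inv_nhdsGT_zero)
  · have hN' : max (M C₀) 1 < N := (le_max_left _ _).trans_lt hN
    refine ⟨fun i => ?_, fun i j hij => (hest C₀ hC N hN' ψ hψ i j hij).2⟩
    obtain ⟨j, hij⟩ := hother N ((le_max_right _ _).trans_lt hN') i
    exact (hest C₀ hC N hN' ψ hψ i j hij).1
  · have hN1 : 1 < N := (le_max_right _ _).trans_lt hN
    obtain ⟨j, hij⟩ := hother N hN1 ⟨0, by omega⟩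
    exact ManyBody.neg_le_energy_of_le (by omega) hα.2.le
      (hest 1 one_pos N hN ψ hψ ⟨0, by omega⟩ j hij).1
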